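/- Let $K$ be a field and $r\ge 3$. Consider unrooted trees with $r$ leaves numbered $1,\dots,r$, all of whose internal vertices are at least trivalent; the leaves are legs attached to internal vertices, and an \emph{edge} always means an edge between two internal vertices. Let $\mathbf B\mathsf{Com}((r))$ be the $r$-ary component of the cyclic bar construction of the commutative operad: the cochain complex of $K$-vector spaces generated in degree $-k$ by pairs $(T,e_1\wedge\cdots\wedge e_k)$ of such a tree $T$ with $k$ edges and an ordering $e_1,\dots,e_k$ of its edges, modulo identification of isomorphic pairs (isomorphisms preserve the numbering of the leaves) and $(T,e_{\sigma(1)}\wedge\cdots\wedge e_{\sigma(k)})=\operatorname{sgn}(\sigma)\,(T,e_1\wedge\cdots\wedge e_k)$ for $\sigma\in S_k$, with the edge contraction differential $$d(T,e_1\wedge\cdots\wedge e_k)=\sum_{j=1}^k(-1)^{j-1}\,(T/e_j,\;e_1\wedge\cdots\widehat{e_j}\cdots\wedge e_k).$$ Let $\underline p=(p_1,\dots,p_N)$ be a partition $r=p_1+\cdots+p_N$ with all $p_j\ge 1$ and $N\le r-1$, viewed as a colouring of the leaves: the first $p_1$ leaves have colour $1$, the next $p_2$ leaves have colour $2$, and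 so on. An edge $e$ of $T$ is a $\underline p$-bridge if the sets of leaf colours of the two components of $T\setminus e$ are disjoint, and $T$ is $\underline p$-bridgeless if it has no $\underline p$-bridge. Being $\underline p$-bridgeless is stable under edge contraction; let $V_{r,\underline p}\subset\mathbf B\mathsf{Com}((r))$ be the subcomplex spanned by the $\underline p$-bridgeless trees. Then $H^{n}(V_{r,\underline p})=0$ for every integer $n\neq 3-r$. Moreover $3-r$ is the bottom degree, i.e. $V_{r,\underline p}^n=0$ for $n<3-r$, and a tree as above has degree $3-r$ if and only if all its internal vertices are trivalent. -/

import Mathlib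

noncomputable section

open CategoryTheory

namespace CyclicBar

/-! ### Unrooted trees with numbered leaves -/

/-- The valence of the vertex `v`: the number of edges plus the number of leaves attached to `v`. -/
def valenceOf {r k n : ℕ} (edge : Fin k → Sym2 (Fin n)) (leg : Fin r → Fin n) (v : Fin n) : ℕ :=
  (Finset.univ.filter fun i => v ∈ edge i).card + (Finset.univ.filter fun a => leg a = v).card

/-- An unrooted tree with `r` numbered leaves and `k` edges, whose edges are listed in a fixed order
(this order is the orientation). The vertices, all of which are internal and at least trivalent, are
`0, …, k`; the leaf `a` is a leg attached to the vertex `leg a`. Legs are not edges. As the tree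
has `k + 1` vertices, the `k` entries of the list `edge` are necessarily distinct. -/
structure OrientedTree (r k : ℕ) where
  edge : Fin k → Sym2 (Fin (k + 1))
  leg : Fin r → Fin (k + 1)
  isTree : (SimpleGraph.fromEdgeSet (Set.range edge)).IsTree
  three_le : ∀ v, 3 ≤ valenceOf edge leg v

namespace OrientedTree

variable {r k : ℕ}

/-- The graph formed by the vertices and the edges of the tree. -/
def graph (T : OrientedTree r k) : SimpleGraph (Fin (k + 1)) :=
  SimpleGraph.fromEdgeSet (Set.range T.edge)

/-- The valence of a vertex (edges and legs are counted). -/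
def valence (T : OrientedTree r k) (v : Fin (k + 1)) : ℕ := valenceOf T.edge T.leg v

/-- `T` is trivalent if every vertex has valence three. -/
def IsTrivalent (T : OrientedTree r k) : Prop := ∀ v, T.valence v = 3

/-- The graph obtained by removing the edge number `i`. -/
def removeEdge (T : OrientedTree r k) (i : Fin k) : SimpleGraph (Fin (k + 1)) :=
  T.graph.deleteEdges {T.edge i}

/-- For a colouring `c` of the leaves, the edge number `i` is a bridge if any two leaves which
lie in different components after removal of this edge have different colours, i.e. if the two
components have disjoint sets of leaf colours. -/
def IsBridge {C : Type*} (T : OrientedTree r k) (c : Fin r → C) (i : Fin k) : Prop :=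
  ∀ a b : Fin r, ¬ (T.removeEdge i).Reachable (T.leg a) (T.leg b) → c a ≠ c b

/-- A tree is bridgeless, with respect to a colouring of its leaves, if it has no bridge. -/
def IsBridgeless {C : Type*} (T : OrientedTree r k) (c : Fin r → C) : Prop :=
  ∀ i, ¬ T.IsBridge c i

/-- An isomorphism of trees: a bijection of the vertices compatible with the leaves and with the
edges. The permutation `σ` describes how the edges are reordered. -/
def IsIso (T T' : OrientedTree r k) (φ : Equiv.Perm (Fin (k + 1))) (σ : Equiv.Perm (Fin k)) :
    Prop :=
  (∀ a, T'.leg a = φ (T.leg a)) ∧ ∀ i, T'.edge (σ i) = (T.edge i).map φ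

lemma nat_card_range_le {α : Type*} (f : Fin k → α) : Nat.card (Set.range f) ≤ k := by
  simpa using Finite.card_range_le f

lemma fromEdgeSet_edgeSet_subset {V : Type*} (s : Set (Sym2 V)) :
    (SimpleGraph.fromEdgeSet s).edgeSet ⊆ s := by
  rw [SimpleGraph.edgeSet_fromEdgeSet]; exact Set.sdiff_subset

lemma edgeSet_eq (T : OrientedTree r k) : T.graph.edgeSet = Set.range T.edge ∧
    Nat.card (Set.range T.edge) = k := by
  have h1 := (SimpleGraph.isTree_iff_connected_and_card.1 T.isTree).2
  have hsub := fromEdgeSet_edgeSet_subset (Set.range T.edge)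
  have h2 : Nat.card (SimpleGraph.fromEdgeSet (Set.range T.edge)).edgeSet = k := by
    simpa using h1
  have h3 := nat_card_range_le T.edge
  have h4 := Set.eq_of_subset_of_ncard_le hsub
    (by rw [← Nat.card_coe_set_eq, ← Nat.card_coe_set_eq, h2]; exact h3)
  refine ⟨h4, ?_⟩
  rw [← h4]; exact h2

lemma edge_injective (T : OrientedTree r k) : Function.Injective T.edge := by
  have h := T.edgeSet_eq.2
  rw [Nat.card_coe_set_eq, ← Set.image_univ] at h
  have := (Set.ncard_image_iff (s := Set.univ) (f := T.edge)).1 (by simpa using h)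
  exact Set.injOn_univ.1 this

lemma edge_not_isDiag (T : OrientedTree r k) (i : Fin k) : ¬ (T.edge i).IsDiag := by
  have : T.edge i ∈ T.graph.edgeSet := by rw [T.edgeSet_eq.1]; exact ⟨i, rfl⟩
  exact T.graph.not_isDiag_of_mem_edgeSet this

/-! ### Edge contraction -/

/-- The endpoints of an edge can be merged. -/
lemma exists_collapse (e : Sym2 (Fin (k + 2))) (he : ¬ e.IsDiag) :
    ∃ π : Fin (k + 2) → Fin (k + 1), Function.Surjective π ∧
      ∀ x y, π x = π y ↔ x = y ∨ e = s(x, y) := by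
  induction e with
  | _ a b =>
  have hab : a ≠ b := by simpa using he
  let q := (finSuccAboveEquiv b).symm
  refine ⟨fun x => if h : x = b then q ⟨a, hab⟩ else q ⟨x, h⟩, ?_, ?_⟩
  · intro y
    obtain ⟨⟨x, hx⟩, rfl⟩ := q.surjective y
    exact ⟨x, by simp [hx]⟩
  · intro x y
    by_cases hx : x = b <;> by_cases hy : y = b <;>
      simp only [hx, hy, dite_true, dite_false, q.apply_eq_iff_eq, Subtype.mk.injEq, Sym2.eq_iff]
        <;> grind

/-- The map which merges the two endpoints of the edge number `i`; its fibres are these two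
endpoints and the remaining single vertices. -/
def collapse (T : OrientedTree r (k + 1)) (i : Fin (k + 1)) : Fin (k + 2) → Fin (k + 1) :=
  (exists_collapse (T.edge i) (T.edge_not_isDiag i)).choose

lemma collapse_surjective (T : OrientedTree r (k + 1)) (i : Fin (k + 1)) :
    Function.Surjective (T.collapse i) :=
  (exists_collapse (T.edge i) (T.edge_not_isDiag i)).choose_spec.1

lemma collapse_eq_iff (T : OrientedTree r (k + 1)) (i : Fin (k + 1)) (x y : Fin (k + 2)) :
    T.collapse i x = T.collapse i y ↔ x = y ∨ T.edge i = s(x, y) :=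
  (exists_collapse (T.edge i) (T.edge_not_isDiag i)).choose_spec.2 x y

lemma contract_isTree (T : OrientedTree r (k + 1)) (i : Fin (k + 1)) :
    (SimpleGraph.fromEdgeSet (Set.range fun j : Fin k =>
      (T.edge (i.succAbove j)).map (T.collapse i))).IsTree := by
  set π := T.collapse i with hπ
  set G := SimpleGraph.fromEdgeSet (Set.range fun j : Fin k => (T.edge (i.succAbove j)).map π)
  have hconn : G.Connected := by
    refine (SimpleGraph.connected_iff _).2 ⟨?_, inferInstance⟩
    have key : ∀ x y : Fin (k + 2), T.graph.Reachable x y → G.Reachable (π x) (π y) := by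
      rintro x y ⟨w⟩
      induction w with
      | nil => exact SimpleGraph.Reachable.refl _
      | cons h _ ih =>
        rename_i u v _ _
        refine SimpleGraph.Reachable.trans ?_ ih
        by_cases huv : π u = π v
        · rw [huv]
        · obtain ⟨⟨l, hl⟩, -⟩ := (SimpleGraph.fromEdgeSet_adj _).1 h
          have hli : l ≠ i := by
            rintro rfl
            exact huv ((T.collapse_eq_iff l u v).2 (Or.inr hl))
          obtain ⟨j, rfl⟩ := Fin.exists_succAbove_eq hli
          refine SimpleGraph.Adj.reachable ((SimpleGraph.fromEdgeSet_adj _).2 ⟨⟨j, ?_⟩, huv⟩)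
          simp [hl]
    intro x y
    obtain ⟨x, rfl⟩ := T.collapse_surjective i x
    obtain ⟨y, rfl⟩ := T.collapse_surjective i y
    exact key x y (T.isTree.connected x y)
  refine SimpleGraph.isTree_iff_connected_and_card.2 ⟨hconn, le_antisymm ?_ ?_⟩
  · have h1 : Nat.card G.edgeSet ≤ k := by
      refine le_trans ?_ (nat_card_range_le fun j : Fin k => (T.edge (i.succAbove j)).map π)
      rw [Nat.card_coe_set_eq, Nat.card_coe_set_eq]
      exact Set.ncard_le_ncard (fromEdgeSet_edgeSet_subset _)
    simpa using h1
  · exact hconn.card_vert_le_card_edgeSet_add_one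

lemma contract_three_le (T : OrientedTree r (k + 1)) (i : Fin (k + 1)) (v : Fin (k + 1)) :
    3 ≤ valenceOf (fun j : Fin k => (T.edge (i.succAbove j)).map (T.collapse i))
      (fun a => T.collapse i (T.leg a)) v := by
  set π := T.collapse i with hπ
  have hcard : ∀ (p : Fin (k + 1) → Prop) [DecidablePred p], (Finset.univ.filter p).card ≤
      (Finset.univ.filter fun j : Fin k => p (i.succAbove j)).card + 1 := by
    intro p _
    have hsub : Finset.univ.filter p ⊆
        insert i ((Finset.univ.filter fun j : Fin k => p (i.succAbove j)).image i.succAbove) := by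
      intro l hl
      by_cases hli : l = i
      · simp [hli]
      · obtain ⟨j, rfl⟩ := Fin.exists_succAbove_eq hli
        simp only [Finset.mem_filter, Finset.mem_univ, true_and] at hl
        exact Finset.mem_insert_of_mem (Finset.mem_image_of_mem _ (by simp [hl]))
    exact (Finset.card_le_card hsub).trans ((Finset.card_insert_le _ _).trans
      (Nat.add_le_add_right Finset.card_image_le 1))
  have hcard' : ∀ (p : Fin (k + 1) → Prop) [DecidablePred p], ¬ p i → (Finset.univ.filter p).card ≤
      (Finset.univ.filter fun j : Fin k => p (i.succAbove j)).card := by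
    intro p _ hp
    have hsub : Finset.univ.filter p ⊆
        (Finset.univ.filter fun j : Fin k => p (i.succAbove j)).image i.succAbove := by
      intro l hl
      simp only [Finset.mem_filter, Finset.mem_univ, true_and] at hl
      have hli : l ≠ i := by rintro rfl; exact hp hl
      obtain ⟨j, rfl⟩ := Fin.exists_succAbove_eq hli
      exact Finset.mem_image_of_mem _ (by simp [hl])
    exact (Finset.card_le_card hsub).trans Finset.card_image_le
  obtain ⟨x, rfl⟩ := T.collapse_surjective i v
  by_cases hx : x ∈ T.edge i
  · obtain ⟨y, hy⟩ := Sym2.mem_iff_exists.1 hx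
    have hxy : x ≠ y := by
      have := T.edge_not_isDiag i
      rw [hy] at this
      simpa using this
    have hπxy : π x = π y := (T.collapse_eq_iff i x y).2 (Or.inr hy)
    have hX := T.three_le x
    have hY := T.three_le y
    unfold valenceOf at hX hY ⊢
    have h1 := hcard (fun l => x ∈ T.edge l)
    have h2 := hcard (fun l => y ∈ T.edge l)
    have h3 : (Finset.univ.filter fun j : Fin k => x ∈ T.edge (i.succAbove j)).card +
        (Finset.univ.filter fun j : Fin k => y ∈ T.edge (i.succAbove j)).card ≤
        (Finset.univ.filter fun j : Fin k => π x ∈ (T.edge (i.succAbove j)).map π).card := by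
      rw [← Finset.card_union_of_disjoint]
      · refine Finset.card_le_card fun j hj => ?_
        simp only [Finset.mem_union, Finset.mem_filter, Finset.mem_univ, true_and] at hj ⊢
        rcases hj with hj | hj
        · exact Sym2.mem_map.2 ⟨x, hj, rfl⟩
        · exact Sym2.mem_map.2 ⟨y, hj, hπxy.symm⟩
      · refine Finset.disjoint_left.2 fun j hj hj' => ?_
        simp only [Finset.mem_filter, Finset.mem_univ, true_and] at hj hj'
        have := (Sym2.mem_and_mem_iff hxy).1 ⟨hj, hj'⟩
        exact Fin.succAbove_ne i j (T.edge_injective (this.trans hy.symm))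
    have h4 : (Finset.univ.filter fun a => T.leg a = x).card +
        (Finset.univ.filter fun a => T.leg a = y).card ≤
        (Finset.univ.filter fun a => π (T.leg a) = π x).card := by
      rw [← Finset.card_union_of_disjoint]
      · refine Finset.card_le_card fun j hj => ?_
        simp only [Finset.mem_union, Finset.mem_filter, Finset.mem_univ, true_and] at hj ⊢
        rcases hj with hj | hj
        · rw [hj]
        · rw [hj, hπxy]
      · refine Finset.disjoint_left.2 fun j hj hj' => ?_
        simp only [Finset.mem_filter, Finset.mem_univ, true_and] at hj hj'
        exact hxy (hj.symm.trans hj')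
    change 3 ≤ (Finset.univ.filter fun j : Fin k => π x ∈ (T.edge (i.succAbove j)).map π).card +
      (Finset.univ.filter fun a => π (T.leg a) = π x).card
    omega
  · have hX := T.three_le x
    unfold valenceOf at hX ⊢
    have h1 := hcard' (fun l => x ∈ T.edge l) hx
    have h3 : (Finset.univ.filter fun j : Fin k => x ∈ T.edge (i.succAbove j)).card ≤
        (Finset.univ.filter fun j : Fin k => π x ∈ (T.edge (i.succAbove j)).map π).card := by
      refine Finset.card_le_card fun j hj => ?_
      simp only [Finset.mem_filter, Finset.mem_univ, true_and] at hj ⊢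
      exact Sym2.mem_map.2 ⟨x, hj, rfl⟩
    have h4 : (Finset.univ.filter fun a => T.leg a = x).card ≤
        (Finset.univ.filter fun a => π (T.leg a) = π x).card := by
      refine Finset.card_le_card fun j hj => ?_
      simp only [Finset.mem_filter, Finset.mem_univ, true_and] at hj ⊢
      rw [hj]
    change 3 ≤ (Finset.univ.filter fun j : Fin k => π x ∈ (T.edge (i.succAbove j)).map π).card +
      (Finset.univ.filter fun a => π (T.leg a) = π x).card
    omega

/-- The tree `T / e` for `e` the edge number `i`: the two endpoints of `e` are merged, and the
other edges are kept in their order. -/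
def contract (T : OrientedTree r (k + 1)) (i : Fin (k + 1)) : OrientedTree r k where
  edge j := (T.edge (i.succAbove j)).map (T.collapse i)
  leg a := T.collapse i (T.leg a)
  isTree := T.contract_isTree i
  three_le := T.contract_three_le i

lemma removeEdge_adj (T : OrientedTree r k) (i : Fin k) (x y : Fin (k + 1)) :
    (T.removeEdge i).Adj x y ↔ ∃ l, l ≠ i ∧ T.edge l = s(x, y) := by
  rw [removeEdge, SimpleGraph.deleteEdges_adj, ← SimpleGraph.mem_edgeSet, T.edgeSet_eq.1]
  constructor
  · rintro ⟨⟨l, hl⟩, h⟩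
    refine ⟨l, ?_, hl⟩
    rintro rfl
    exact h (by simp [hl])
  · rintro ⟨l, hl, h⟩
    refine ⟨⟨l, h⟩, ?_⟩
    rw [Set.mem_singleton_iff, ← h]
    exact fun h' => hl (T.edge_injective h')

/-- Being bridgeless is stable under edge contraction. -/
lemma IsBridgeless.contract {C : Type*} {T : OrientedTree r (k + 1)} {c : Fin r → C}
    (hT : T.IsBridgeless c) (i : Fin (k + 1)) : (T.contract i).IsBridgeless c := by
  intro j hj
  refine hT (i.succAbove j) fun a b hab => hj a b fun hr => hab ?_
  have fib : ∀ x y : Fin (k + 2), T.collapse i x = T.collapse i y →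
      (T.removeEdge (i.succAbove j)).Reachable x y := by
    intro x y hxy
    rcases (T.collapse_eq_iff i x y).1 hxy with rfl | h
    · exact SimpleGraph.Reachable.refl _
    · exact SimpleGraph.Adj.reachable
        ((T.removeEdge_adj _ _ _).2 ⟨i, (Fin.succAbove_ne i j).symm, h⟩)
  have key : ∀ u v, ((T.contract i).removeEdge j).Reachable u v → ∀ x y, T.collapse i x = u →
      T.collapse i y = v → (T.removeEdge (i.succAbove j)).Reachable x y := by
    rintro u v ⟨w⟩
    induction w with
    | nil => intro x y hx hy; exact fib x y (hx.trans hy.symm)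
    | cons h _ ih =>
      intro x y hx hy
      obtain ⟨l, hl, he⟩ := ((T.contract i).removeEdge_adj _ _ _).1 h
      change (T.edge (i.succAbove l)).map (T.collapse i) = _ at he
      revert he
      induction hpq : T.edge (i.succAbove l) with
      | _ p q =>
      intro he
      have hl' : i.succAbove l ≠ i.succAbove j := fun h => hl (Fin.succAbove_right_injective h)
      have hadj : (T.removeEdge (i.succAbove j)).Reachable p q :=
        SimpleGraph.Adj.reachable ((T.removeEdge_adj _ _ _).2 ⟨_, hl', hpq⟩)
      rw [Sym2.map_mk, Sym2.eq_iff] at he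
      rcases he with ⟨h1, h2⟩ | ⟨h1, h2⟩
      · exact (fib x p (hx.trans h1.symm)).trans (hadj.trans (ih q y h2 hy))
      · exact (fib x q (hx.trans h2.symm)).trans (hadj.symm.trans (ih p y h1 hy))
  exact key _ _ hr _ _ rfl rfl

/-! ### Compatibility of contraction with isomorphisms -/

lemma exists_perm {X : Type*} {n : ℕ} (f g : X → Fin n) (hf : Function.Surjective f)
    (hg : Function.Surjective g) (h : ∀ x y, f x = f y ↔ g x = g y) :
    ∃ φ : Equiv.Perm (Fin n), ∀ x, φ (f x) = g x := by
  choose s hs using hf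
  have hφ : ∀ x, g (s (f x)) = g x := fun x => (h _ _).1 (hs _)
  refine ⟨Equiv.ofBijective (fun y => g (s y)) ⟨fun y z hyz => ?_, fun z => ?_⟩, hφ⟩
  · have := (h _ _).2 hyz
    rwa [hs, hs] at this
  · obtain ⟨x, rfl⟩ := hg z
    exact ⟨f x, hφ x⟩

/-- The permutation induced on the complement of an element, and its sign. -/
lemma exists_induced_perm (σ : Equiv.Perm (Fin (k + 1))) (i : Fin (k + 1)) :
    ∃ τ : Equiv.Perm (Fin k), (∀ j, σ (i.succAbove j) = (σ i).succAbove (τ j)) ∧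
      ((-1) ^ (σ i : ℕ) * Equiv.Perm.sign τ : ℤˣ) = (-1) ^ (i : ℕ) * Equiv.Perm.sign σ := by
  set μ : Equiv.Perm (Fin (k + 1)) := (σ i).cycleRange * σ * (i.cycleRange)⁻¹ with hμ
  have hμ0 : μ 0 = 0 := by
    simp [hμ, Equiv.Perm.mul_apply, Equiv.Perm.inv_def, Fin.cycleRange_symm_zero]
  obtain ⟨⟨p, τ⟩, hpτ⟩ := Equiv.Perm.decomposeFin.symm.surjective μ
  have hp : p = 0 := by
    have := Equiv.Perm.decomposeFin_symm_apply_zero p τ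
    rw [hpτ, hμ0] at this
    exact this.symm
  subst hp
  have hsucc : ∀ j, μ j.succ = (τ j).succ := by
    intro j
    rw [← hpτ, Equiv.Perm.decomposeFin_symm_apply_succ]
    simp
  refine ⟨τ, fun j => ?_, ?_⟩
  · have h := hsucc j
    rw [hμ, Equiv.Perm.mul_apply, Equiv.Perm.mul_apply, Equiv.Perm.inv_def,
      Fin.cycleRange_symm_succ] at h
    rw [← Fin.cycleRange_symm_succ (σ i), ← h, Equiv.symm_apply_apply]
  · have h := Equiv.Perm.decomposeFin.symm_sign 0 τ
    rw [hpτ, if_pos rfl, one_mul, hμ] at h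
    rw [← h, Equiv.Perm.sign_mul, Equiv.Perm.sign_mul, Equiv.Perm.sign_inv, Fin.sign_cycleRange,
      Fin.sign_cycleRange, ← mul_assoc, ← mul_assoc, ← mul_pow]
    simp [mul_comm]

lemma IsIso.contract {T T' : OrientedTree r (k + 1)} {φ : Equiv.Perm (Fin (k + 2))}
    {σ : Equiv.Perm (Fin (k + 1))} (h : T.IsIso T' φ σ) (i : Fin (k + 1)) (τ : Equiv.Perm (Fin k))
    (hτ : ∀ j, σ (i.succAbove j) = (σ i).succAbove (τ j)) :
    ∃ φ', (T.contract i).IsIso (T'.contract (σ i)) φ' τ := by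
  obtain ⟨φ', hφ'⟩ := exists_perm (T.collapse i) (fun x => T'.collapse (σ i) (φ x))
    (T.collapse_surjective i) ((T'.collapse_surjective (σ i)).comp φ.surjective) (by
      intro x y
      rw [T.collapse_eq_iff, T'.collapse_eq_iff, h.2, φ.apply_eq_iff_eq, ← Sym2.map_mk,
        (Sym2.map.injective φ.injective).eq_iff])
  refine ⟨φ', fun a => ?_, fun j => ?_⟩
  · change T'.collapse (σ i) (T'.leg a) = φ' (T.collapse i (T.leg a))
    rw [hφ', h.1]
  · change (T'.edge ((σ i).succAbove (τ j))).map (T'.collapse (σ i)) =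
      ((T.edge (i.succAbove j)).map (T.collapse i)).map φ'
    rw [← hτ, h.2, Sym2.map_map, Sym2.map_map]
    congr 1
    funext x
    exact (hφ' x).symm

lemma collapse_collapse_eq_iff (T : OrientedTree r (k + 2)) (i : Fin (k + 2)) (j : Fin (k + 1))
    (x y : Fin (k + 3)) :
    (T.contract i).collapse j (T.collapse i x) = (T.contract i).collapse j (T.collapse i y) ↔
      Relation.EqvGen (fun u v => T.edge i = s(u, v) ∨ T.edge (i.succAbove j) = s(u, v)) x y := by
  constructor
  · have fib : ∀ x y, T.collapse i x = T.collapse i y → Relation.EqvGen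
        (fun u v => T.edge i = s(u, v) ∨ T.edge (i.succAbove j) = s(u, v)) x y := by
      intro x y h
      rcases (T.collapse_eq_iff i x y).1 h with rfl | h
      · exact Relation.EqvGen.refl _
      · exact Relation.EqvGen.rel _ _ (Or.inl h)
    intro h
    rcases ((T.contract i).collapse_eq_iff j _ _).1 h with h | h
    · exact fib x y h
    · change (T.edge (i.succAbove j)).map (T.collapse i) = _ at h
      revert h
      induction hpq : T.edge (i.succAbove j) with
      | _ p q =>
      intro h
      rw [hpq] at fib
      have hr : Relation.EqvGen (fun u v => T.edge i = s(u, v) ∨ s(p, q) = s(u, v)) p q :=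
        Relation.EqvGen.rel _ _ (Or.inr rfl)
      rw [Sym2.map_mk, Sym2.eq_iff] at h
      rcases h with ⟨h1, h2⟩ | ⟨h1, h2⟩
      · exact ((fib x p h1.symm).trans _ _ _ hr).trans _ _ _ (fib q y h2)
      · exact ((fib x q h2.symm).trans _ _ _ (hr.symm _ _)).trans _ _ _ (fib p y h1)
  · intro h
    induction h with
    | rel u v h =>
      rcases h with h | h
      · rw [(T.collapse_eq_iff i u v).2 (Or.inr h)]
      · refine ((T.contract i).collapse_eq_iff j _ _).2 (Or.inr ?_)
        change (T.edge (i.succAbove j)).map (T.collapse i) = _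
        rw [h, Sym2.map_mk]
    | refl => rfl
    | symm _ _ _ ih => exact ih.symm
    | trans _ _ _ _ _ ih1 ih2 => exact ih1.trans ih2

lemma contract_contract_isIso (T : OrientedTree r (k + 2)) (i : Fin (k + 2)) (j : Fin (k + 1)) :
    ∃ φ, ((T.contract i).contract j).IsIso
      ((T.contract (i.succAbove j)).contract (j.predAbove i)) φ 1 := by
  obtain ⟨φ, hφ⟩ := exists_perm (fun x => (T.contract i).collapse j (T.collapse i x))
    (fun x => (T.contract (i.succAbove j)).collapse (j.predAbove i) (T.collapse (i.succAbove j) x))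
    (((T.contract i).collapse_surjective j).comp (T.collapse_surjective i))
    (((T.contract (i.succAbove j)).collapse_surjective _).comp (T.collapse_surjective _)) (by
      intro x y
      rw [collapse_collapse_eq_iff, collapse_collapse_eq_iff, Fin.succAbove_succAbove_predAbove]
      simp only [or_comm])
  refine ⟨φ, fun a => (hφ _).symm, fun l => ?_⟩
  change ((T.edge ((i.succAbove j).succAbove ((j.predAbove i).succAbove l))).map _).map _ =
    (((T.edge (i.succAbove (j.succAbove l))).map _).map _).map _
  rw [Fin.succAbove_succAbove_succAbove_predAbove, Sym2.map_map, Sym2.map_map, Sym2.map_map]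
  congr 1
  funext x
  exact (hφ x).symm

end OrientedTree

/-! ### The cyclic bar construction of the commutative operad -/

universe u

variable (K : Type u) [Field K]

/-- The relations between oriented trees: isomorphic trees are identified, and a reordering of the
edges by a permutation `σ` acts by the sign of `σ`. -/
def relations (r k : ℕ) : Submodule K (OrientedTree r k →₀ K) :=
  Submodule.span K {x | ∃ (T T' : OrientedTree r k) (φ : Equiv.Perm (Fin (k + 1)))
    (σ : Equiv.Perm (Fin k)), T.IsIso T' φ σ ∧
      x = Finsupp.single T' 1 - ((Equiv.Perm.sign σ : ℤ) : K) • Finsupp.single T 1}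

/-- Linear combinations of oriented trees with `r` numbered leaves and `k` edges. -/
abbrev Chain (r k : ℕ) : Type u := (OrientedTree r k →₀ K) ⧸ relations K r k

variable {r k : ℕ}

/-- The class of an oriented tree. -/
def treeClass (T : OrientedTree r k) : Chain K r k :=
  (relations K r k).mkQ (Finsupp.single T 1)

lemma treeClass_eq_of_isIso {T T' : OrientedTree r k} {φ : Equiv.Perm (Fin (k + 1))}
    {σ : Equiv.Perm (Fin k)} (h : T.IsIso T' φ σ) :
    treeClass K T' = ((Equiv.Perm.sign σ : ℤ) : K) • treeClass K T := by
  rw [treeClass, treeClass, ← map_smul, ← sub_eq_zero, ← map_sub, Submodule.mkQ_apply,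
    Submodule.Quotient.mk_eq_zero]
  exact Submodule.subset_span ⟨T, T', φ, σ, h, rfl⟩

/-- The sum over all edges of the contracted trees, with the usual signs. -/
def contractionSum (T : OrientedTree r (k + 1)) : Chain K r k :=
  ∑ i : Fin (k + 1), (-1 : K) ^ (i : ℕ) • treeClass K (T.contract i)

lemma contractionSum_eq_of_isIso {T T' : OrientedTree r (k + 1)} {φ : Equiv.Perm (Fin (k + 2))}
    {σ : Equiv.Perm (Fin (k + 1))} (h : T.IsIso T' φ σ) :
    contractionSum K T' = ((Equiv.Perm.sign σ : ℤ) : K) • contractionSum K T := by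
  rw [contractionSum, contractionSum, ← Equiv.sum_comp σ, Finset.smul_sum]
  refine Finset.sum_congr rfl fun i _ => ?_
  obtain ⟨τ, hτ, hs⟩ := OrientedTree.exists_induced_perm σ i
  obtain ⟨φ', hφ'⟩ := h.contract i τ hτ
  rw [treeClass_eq_of_isIso K hφ', smul_smul, smul_smul]
  congr 1
  have := congrArg (fun u : ℤˣ => ((u : ℤ) : K)) hs
  push_cast at this
  rw [this, mul_comm]

lemma relations_le_ker (r k : ℕ) : relations K r (k + 1) ≤
    LinearMap.ker (Finsupp.linearCombination K (contractionSum K (r := r) (k := k))) := by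
  refine Submodule.span_le.2 ?_
  rintro _ ⟨T, T', φ, σ, h, rfl⟩
  simp [contractionSum_eq_of_isIso K h]

/-- The differential of the cyclic bar construction, `T ↦ ∑ᵢ (-1)^i T / eᵢ`. -/
def differential (r k : ℕ) : Chain K r (k + 1) →ₗ[K] Chain K r k :=
  (relations K r (k + 1)).liftQ (Finsupp.linearCombination K (contractionSum K))
    (relations_le_ker K r k)

@[simp]
lemma differential_treeClass (T : OrientedTree r (k + 1)) :
    differential K r k (treeClass K T) =
      ∑ i : Fin (k + 1), (-1 : K) ^ (i : ℕ) • treeClass K (T.contract i) := by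
  rw [differential, treeClass, Submodule.mkQ_apply, Submodule.liftQ_apply _ _ (h := relations_le_ker K r k),
    Finsupp.linearCombination_single, one_smul, contractionSum]

lemma chain_induction {p : Chain K r k → Prop} (x : Chain K r k) (h0 : p 0)
    (hadd : ∀ x y, p x → p y → p (x + y)) (hT : ∀ (a : K) T, p (a • treeClass K T)) : p x := by
  obtain ⟨f, rfl⟩ := (relations K r k).mkQ_surjective x
  induction f using Finsupp.induction_linear with
  | zero => simpa using h0
  | add f g hf hg => rw [map_add]; exact hadd _ _ hf hg
  | single T a =>
    have := hT a T
    rwa [treeClass, ← map_smul, Finsupp.smul_single, smul_eq_mul, mul_one] at this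

lemma differential_differential_treeClass (T : OrientedTree r (k + 2)) :
    differential K r k (differential K r (k + 1) (treeClass K T)) = 0 := by
  simp only [differential_treeClass, map_sum, map_smul, Finset.smul_sum, smul_smul, ← pow_add]
  rw [← Fintype.sum_prod_type']
  refine Finset.sum_involution (fun q _ => (q.1.succAbove q.2, q.2.predAbove q.1)) ?_ ?_ ?_ ?_
  · rintro ⟨i, j⟩ -
    obtain ⟨φ, hφ⟩ := T.contract_contract_isIso i j
    have h := treeClass_eq_of_isIso K hφ
    simp only [Equiv.Perm.sign_one, Units.val_one, Int.cast_one, one_smul] at h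
    have hs : (-1 : K) ^ ((i.succAbove j : ℕ) + (j.predAbove i : ℕ)) = -(-1) ^ ((i : ℕ) + j) := by
      rw [Fin.neg_one_pow_succAbove_add_predAbove]
    simp only [h, hs, neg_smul, add_neg_cancel]
  · rintro ⟨i, j⟩ - - h
    exact Fin.succAbove_ne i j (congrArg Prod.fst h)
  · intros; exact Finset.mem_univ _
  · rintro ⟨i, j⟩ -
    refine Prod.ext (Fin.succAbove_succAbove_predAbove i j) ?_
    exact Fin.predAbove_predAbove_succAbove i j

lemma differential_comp_differential (r k : ℕ) :
    differential K r k ∘ₗ differential K r (k + 1) = 0 := by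
  refine LinearMap.ext fun x => ?_
  refine chain_induction K (p := fun x => (differential K r k ∘ₗ differential K r (k + 1)) x = 0)
    x ?_ ?_ ?_
  · simp
  · intro x y hx hy; rw [map_add, hx, hy, add_zero]
  · intro a T
    simp [-differential_treeClass, differential_differential_treeClass]

/-- The component `BCom((r))` of the cyclic bar construction of the commutative operad, as a
cochain complex: trees with `k` edges have degree `-k`. -/
def barCom (r : ℕ) : CochainComplex (ModuleCat.{u} K) ℤ :=
  (ChainComplex.of (fun k => ModuleCat.of K (Chain K r k))
    (fun k => ModuleCat.ofHom (differential K r k)) (fun k => by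
      rw [← ModuleCat.ofHom_comp, differential_comp_differential]; rfl)).extend
    ComplexShape.embeddingDownNat

/-! ### The bridgeless subcomplex -/

/-- The subspace spanned by the trees which are bridgeless for the given colouring. -/
def bridgelessChain {C : Type*} (c : Fin r → C) (k : ℕ) : Submodule K (Chain K r k) :=
  Submodule.span K {x | ∃ T : OrientedTree r k, T.IsBridgeless c ∧ x = treeClass K T}

lemma differential_mem_bridgelessChain {C : Type*} (c : Fin r → C) (k : ℕ) :
    ∀ x ∈ bridgelessChain K c (k + 1), differential K r k x ∈ bridgelessChain K c k := by
  intro x hx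
  induction hx using Submodule.span_induction with
  | mem x hx =>
    obtain ⟨T, hT, rfl⟩ := hx
    rw [differential_treeClass]
    exact Submodule.sum_mem _ fun i _ => Submodule.smul_mem _ _
      (Submodule.subset_span ⟨_, hT.contract i, rfl⟩)
  | zero => simp
  | add x y _ _ hx hy => rw [map_add]; exact Submodule.add_mem _ hx hy
  | smul a x _ hx => rw [map_smul]; exact Submodule.smul_mem _ _ hx

/-- The differential restricted to the bridgeless part. -/
def bridgelessDifferential {C : Type*} (c : Fin r → C) (k : ℕ) :
    bridgelessChain K c (k + 1) →ₗ[K] bridgelessChain K c k :=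
  (differential K r k).restrict (differential_mem_bridgelessChain K c k)

/-- The subcomplex of `BCom((r))` spanned by the trees which are bridgeless for the
colouring `c` of the leaves; trees with `k` edges have degree `-k`. -/
def bridgelessComplex {C : Type*} (c : Fin r → C) : CochainComplex (ModuleCat.{u} K) ℤ :=
  (ChainComplex.of (fun k => ModuleCat.of K (bridgelessChain K c k))
    (fun k => ModuleCat.ofHom (bridgelessDifferential K c k)) (fun k => by
      rw [← ModuleCat.ofHom_comp]
      have : bridgelessDifferential K c k ∘ₗ bridgelessDifferential K c (k + 1) = 0 := by
        ext x
        exact LinearMap.congr_fun (differential_comp_differential K r k) x.1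
      rw [this]; rfl)).extend
    ComplexShape.embeddingDownNat

end CyclicBar

end

/-! Root every tree at a leaf `x`. Cutting an edge separates a set of leaves from `x`, the split of
that edge. Because vertices are at least trivalent, a split has between 2 and `r - 2` elements; the
splits of one tree are distinct and pairwise nested or disjoint. Every such family comes from a tree
(`OrientedTree.exists_split_eq`), unique up to isomorphism (`OrientedTree.exists_isIso`), and
contracting an edge deletes its split. So the cyclic bar construction is the augmented simplicial
chain complex of the clique complex of laminarity, a tree with `k` edges being a simplex with `k`
vertices. A tree is bridgeless iff each of its splits separates two leaves of the same colour.
`splitMap` realises this identification inside an exterior algebra, which takes care of the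
orientation signs.

As there are fewer colours than leaves, `x` can be chosen to share its colour with another leaf. It
remains to see that the clique complex of the colour-splitting proper subsets of `E`, the set of
leaves other than `x`, has reduced homology only on cliques of `r - 3` sets. `TopAcyclic` is a
certificate for such a statement: a cone is acyclic, and attaching a vertex whose link is
concentrated in cliques of size `d` preserves concentration in size `d + 1` (`TopAcyclic.exact`).

The certificate is built by induction on `E` (`topAcyclic_colourSplitting`), for any `E` containing
some `y` whose colour also occurs outside `E`. Every proper subset containing `y` is then
colour-splitting; these subsets form the order complex of the proper part of a Boolean lattice, a
sphere (`topAcyclic_pointedSubsets`). The sets `S` avoiding `y` are attached by increasing size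
(`topAcyclic_union`). The link of such an `S` is a join: the colour-splitting proper subsets of `S`,
covered by induction, and a complex of the same kind on `E` with `S` shrunk to a point. -/

namespace CyclicBar

/-! ### A combinatorial criterion for acyclicity below the top degree -/

/-- A sufficient condition for the clique complex of the relation `R` on the finite set `W` of
vertices to have reduced homology only in the degree of the cliques with `d` elements. -/
inductive TopAcyclic {V : Type*} [DecidableEq V] (R : V → V → Prop) : Finset V → ℕ → Prop
  | empty : TopAcyclic R ∅ 0
  | cone (W : Finset V) (d : ℕ) (v : V) (hv : v ∈ W) (h : ∀ w ∈ W, R v w) : TopAcyclic R W d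
  | insert (W L : Finset V) (d : ℕ) (v : V) (hv : v ∉ W) (hL : ∀ w, w ∈ L ↔ w ∈ W ∧ R v w)
      (hW : TopAcyclic R W (d + 1)) (hlink : TopAcyclic R L d) :
      TopAcyclic R (insert v W) (d + 1)

namespace TopAcyclic

variable {V V' : Type*} [DecidableEq V] [DecidableEq V'] {R : V → V → Prop}
  {R' : V' → V' → Prop} {W W' : Finset V} {d d' : ℕ}

/-- The link of `v` in the union is its old link together with all of `W'`, and a cone apex of `W`
remains a cone apex of the union; so the certificate for `W` can be followed step by step, starting
from that for `W'`. -/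
lemma join (h : TopAcyclic R W d) (h' : TopAcyclic R W' d') (hdisj : Disjoint W W')
    (hR : ∀ w ∈ W, ∀ w' ∈ W', R w w') : TopAcyclic R (W ∪ W') (d + d') := by
  induction h with
  | empty => simpa using h'
  | cone W d v hv h =>
    refine cone _ _ v (Finset.mem_union_left _ hv) fun w hw => ?_
    rcases Finset.mem_union.1 hw with hw | hw
    · exact h w hw
    · exact hR v hv w hw
  | insert W L d v hv hL hW hlink ih1 ih2 =>
    rw [Finset.disjoint_insert_left] at hdisj
    have hLW : L ⊆ W := fun w hw => ((hL w).1 hw).1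
    have h1 := ih1 hdisj.2 fun w hw => hR w (Finset.mem_insert_of_mem hw)
    have h2 := ih2 (hdisj.2.mono_left hLW) fun w hw => hR w (Finset.mem_insert_of_mem (hLW hw))
    rw [show d + 1 + d' = d + d' + 1 by omega] at h1 ⊢
    rw [Finset.insert_union]
    refine insert _ _ _ v (by simp [hv, hdisj.1]) (fun w => ?_) h1 h2
    have := hR v (Finset.mem_insert_self _ _) w
    simp only [Finset.mem_union, hL]
    tauto

/-- A certificate involves only the relation restricted to `W`. This carries certificates from a
ground set with a block shrunk to a point back to the original ground set. -/
lemma image (h : TopAcyclic R W d) (f : V → V') (hf : Set.InjOn f W)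
    (hR : ∀ v ∈ W, ∀ w ∈ W, R' (f v) (f w) ↔ R v w) : TopAcyclic R' (W.image f) d := by
  induction h with
  | empty => simpa using empty
  | cone W d v hv h =>
    refine cone _ _ (f v) (Finset.mem_image_of_mem _ hv) ?_
    simp only [Finset.forall_mem_image]
    exact fun w hw => (hR v hv w hw).2 (h w hw)
  | insert W L d v hv hL hW hlink ih1 ih2 =>
    have hLW : L ⊆ W := fun w hw => ((hL w).1 hw).1
    have hWi : ∀ w ∈ W, w ∈ Insert.insert v W := fun w => Finset.mem_insert_of_mem
    have hvi := Finset.mem_insert_self v W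
    rw [Finset.image_insert]
    refine insert _ (L.image f) _ _ ?_ ?_
      (ih1 (hf.mono (by simp)) fun a ha b hb => hR a (hWi a ha) b (hWi b hb))
      (ih2 (hf.mono fun a ha => hWi a (hLW ha)) fun a ha b hb =>
        hR a (hWi a (hLW ha)) b (hWi b (hLW hb)))
    · rw [Finset.mem_image]
      rintro ⟨w, hw, hwv⟩
      exact hv (hf (hWi w hw) hvi hwv ▸ hw)
    · intro w
      simp only [Finset.mem_image, hL]
      constructor
      · rintro ⟨a, ⟨ha, hva⟩, rfl⟩
        exact ⟨⟨a, ha, rfl⟩, (hR v hvi a (hWi a ha)).2 hva⟩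
      · rintro ⟨⟨a, ha, rfl⟩, hva⟩
        exact ⟨a, ⟨ha, (hR v hvi a (hWi a ha)).1 hva⟩, rfl⟩

end TopAcyclic

/-! ### Laminar families of sets -/

section Laminar

variable {α : Type*}

/-- Two finite sets are laminar if they are nested or disjoint. -/
def Laminar (A B : Finset α) : Prop := A ⊆ B ∨ B ⊆ A ∨ Disjoint A B

lemma Laminar.refl (A : Finset α) : Laminar A A := Or.inl subset_rfl

lemma Laminar.symm {A B : Finset α} (h : Laminar A B) : Laminar B A := by
  rcases h with h | h | h
  exacts [Or.inr (Or.inl h), Or.inl h, Or.inr (Or.inr h.symm)]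

variable [DecidableEq α]

/-- The proper subsets of `E` which contain `y` and at least one other element. -/
def pointedSubsets (E : Finset α) (y : α) : Finset (Finset α) :=
  E.powerset.filter fun T => y ∈ T ∧ 2 ≤ T.card ∧ T ≠ E

lemma mem_pointedSubsets {E T : Finset α} {y : α} :
    T ∈ pointedSubsets E y ↔ T ⊆ E ∧ y ∈ T ∧ 2 ≤ T.card ∧ T ≠ E := by
  simp [pointedSubsets]

/-- The sets containing `z` form a cone with apex `{y, z}`. A set `T` without `z`, attached in order
of increasing size, has a link that is a cone with apex `T ∪ {z}`, which is still proper because `T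
≠ E.erase z`. The whole is contractible, so `d` is arbitrary. -/
lemma topAcyclic_pointedSubsets_filter_union {E : Finset α} {y z : α} (hy : y ∈ E) (hz : z ∈ E)
    (hyz : y ≠ z) (hE : 3 ≤ E.card) (d : ℕ) (G : Finset (Finset α))
    (hG : ∀ T ∈ G, T ∈ pointedSubsets E y ∧ z ∉ T ∧ T ≠ E.erase z) :
    TopAcyclic Laminar ((pointedSubsets E y).filter (z ∈ ·) ∪ G) (d + 1) := by
  induction hn : G.card generalizing G with
  | zero =>
    rw [Finset.card_eq_zero.1 hn, Finset.union_empty]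
    have hc : ({y, z} : Finset α).card = 2 := Finset.card_pair hyz
    refine TopAcyclic.cone _ _ {y, z} ?_ fun w hw => Or.inl ?_
    · simp only [Finset.mem_filter, mem_pointedSubsets]
      refine ⟨⟨?_, by simp, hc.ge, ?_⟩, by simp⟩
      · simp [Finset.insert_subset_iff, hy, hz]
      · rintro rfl; omega
    · simp only [Finset.mem_filter, mem_pointedSubsets] at hw
      simp [Finset.insert_subset_iff, hw]
  | succ n ih =>
    have hne : G.Nonempty := by rw [← Finset.card_pos]; omega
    -- A largest set is attached last: the only sets already present that strictly contain `T` then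
    -- contain `z`.
    obtain ⟨T, hT, hmax⟩ := Finset.exists_max_image G Finset.card hne
    obtain ⟨hTE, hzT, hTz⟩ := hG T hT
    rw [mem_pointedSubsets] at hTE
    have h1 := ih (G.erase T) (fun S hS => hG S (Finset.mem_of_mem_erase hS))
      (by rw [Finset.card_erase_of_mem hT, hn]; rfl)
    rw [← Finset.insert_erase hT, Finset.union_insert]
    refine TopAcyclic.insert _ (((pointedSubsets E y).filter (z ∈ ·) ∪ G.erase T).filter
      fun S => S ⊆ T ∨ T ⊆ S) d T ?_ ?_ h1 ?_
    · simp [hzT]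
    · intro S
      simp only [Finset.mem_filter]
      refine and_congr_right fun hS => ?_
      have hyS : y ∈ S := by
        rcases Finset.mem_union.1 hS with hS | hS
        · exact (mem_pointedSubsets.1 (Finset.mem_filter.1 hS).1).2.1
        · exact (mem_pointedSubsets.1 (hG S (Finset.mem_of_mem_erase hS)).1).2.1
      have : ¬ Disjoint T S := Finset.not_disjoint_iff.2 ⟨y, hTE.2.1, hyS⟩
      unfold Laminar
      tauto
    · refine TopAcyclic.cone _ _ (insert z T) ?_ fun S hS => ?_
      · simp only [Finset.mem_filter, Finset.mem_union, mem_pointedSubsets]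
        refine ⟨Or.inl ⟨⟨Finset.insert_subset hz hTE.1, by simp [hTE], ?_, ?_⟩, by simp⟩,
          Or.inr (Finset.subset_insert _ _)⟩
        · exact hTE.2.2.1.trans (Finset.card_le_card (Finset.subset_insert _ _))
        · rintro h
          exact hTz (by rw [← h, Finset.erase_insert hzT])
      · simp only [Finset.mem_filter, Finset.mem_union] at hS
        rcases hS with ⟨hS | hS, h | h⟩
        · exact absurd (h hS.2) hzT
        · exact Or.inl (Finset.insert_subset hS.2 h)
        · exact Or.inr (Or.inl (h.trans (Finset.subset_insert _ _)))
        · have := Finset.eq_of_subset_of_card_le h (hmax S (Finset.mem_of_mem_erase hS))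
          exact absurd this.symm (Finset.ne_of_mem_erase hS)

/-- All sets except `E.erase z` form a contractible complex. The link of `E.erase z` consists of its
own pointed proper subsets, since a larger proper set would have to be `E`; so induction applies
with one point fewer. -/
lemma topAcyclic_pointedSubsets (n : ℕ) {E : Finset α} {y : α} (hy : y ∈ E)
    (hE : E.card = n + 2) : TopAcyclic Laminar (pointedSubsets E y) n := by
  induction n generalizing E with
  | zero =>
    have : pointedSubsets E y = ∅ := Finset.eq_empty_of_forall_notMem fun T hT => by
      rw [mem_pointedSubsets] at hT
      exact hT.2.2.2 (Finset.eq_of_subset_of_card_le hT.1 (by omega))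
    rw [this]
    exact TopAcyclic.empty
  | succ n ih =>
    obtain ⟨z, hz, hzy⟩ := Finset.exists_mem_ne (show 1 < E.card by omega) y
    have hcard : (E.erase z).card = n + 2 := by rw [Finset.card_erase_of_mem hz]; omega
    have hyz : y ∈ E.erase z := Finset.mem_erase.2 ⟨hzy.symm, hy⟩
    set G := (pointedSubsets E y).filter fun T => z ∉ T ∧ T ≠ E.erase z with hG
    have h1 := topAcyclic_pointedSubsets_filter_union hy hz hzy.symm (by omega) n G (by
      intro T hT; simpa [hG] using hT)
    have hmem : E.erase z ∈ pointedSubsets E y :=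
      mem_pointedSubsets.2 ⟨Finset.erase_subset _ _, hyz, by omega, by
        intro h; rw [Finset.erase_eq_self] at h; exact h hz⟩
    have heq : pointedSubsets E y =
        insert (E.erase z) ((pointedSubsets E y).filter (z ∈ ·) ∪ G) := by
      ext T
      simp only [Finset.mem_insert, Finset.mem_union, Finset.mem_filter, hG]
      by_cases h : T = E.erase z
      · simp [h, hmem]
      · simp only [h]; tauto
    rw [heq]
    refine TopAcyclic.insert _ (pointedSubsets (E.erase z) y) n _ (by simp [hG]) ?_ h1
      (ih hyz hcard)
    intro T
    simp only [Finset.mem_union, Finset.mem_filter, hG]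
    constructor
    · intro hT
      rw [mem_pointedSubsets] at hT
      have hzT : z ∉ T := fun h => by simpa using hT.1 h
      refine ⟨Or.inr ⟨mem_pointedSubsets.2 ⟨hT.1.trans (Finset.erase_subset _ _), hT.2.1,
        hT.2.2.1, ?_⟩, hzT, hT.2.2.2⟩, Or.inr (Or.inl hT.1)⟩
      rintro rfl; exact hzT hz
    · rintro ⟨hT | hT, h⟩
      · exfalso
        have hT' := mem_pointedSubsets.1 hT.1
        rcases h with h | h | h
        · apply hT'.2.2.2
          refine subset_antisymm hT'.1 ?_
          rw [← Finset.insert_erase hz]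
          exact Finset.insert_subset hT.2 h
        · simpa using h hT.2
        · exact Finset.disjoint_left.1 h hyz hT'.2.1
      · have hT' := mem_pointedSubsets.1 hT.1
        refine mem_pointedSubsets.2 ⟨fun a ha => Finset.mem_erase.2 ⟨?_, hT'.1 ha⟩, hT'.2.1,
          hT'.2.2.1, hT.2.2⟩
        rintro rfl; exact hT.2.1 ha

end Laminar

/-! ### Attaching the sets that avoid the distinguished point -/

section Laminar

variable {α : Type*} [DecidableEq α]

/-- Replaces the point `s` of a set by the block `S`. -/
def expandPoint (S : Finset α) (s : α) (T : Finset α) : Finset α := if s ∈ T then T ∪ S else T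

lemma mem_expandPoint {S T : Finset α} {s a : α} :
    a ∈ expandPoint S s T ↔ a ∈ T ∨ s ∈ T ∧ a ∈ S := by
  unfold expandPoint; split_ifs with h <;> simp [h]

/-- As `T` meets `S` at most in `s`, no element of `T` is mistaken for one added by the expansion.
Together with the analogous statement on disjointness, this makes expansion preserve and reflect
laminarity. -/
lemma expandPoint_subset_iff {S T U : Finset α} {s : α}
    (hT : ∀ a ∈ T, a ∈ S → a = s) :
    expandPoint S s T ⊆ expandPoint S s U ↔ T ⊆ U := by
  simp only [Finset.subset_iff, mem_expandPoint]
  constructor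
  · intro h a ha
    rcases h (Or.inl ha) with h | h
    · exact h
    · exact hT a ha h.2 ▸ h.1
  · rintro h a (ha | ha)
    · exact Or.inl (h ha)
    · exact Or.inr ⟨h ha.1, ha.2⟩

lemma disjoint_expandPoint_iff {S T U : Finset α} {s : α}
    (hT : ∀ a ∈ T, a ∈ S → a = s) (hU : ∀ a ∈ U, a ∈ S → a = s) :
    Disjoint (expandPoint S s T) (expandPoint S s U) ↔ Disjoint T U := by
  simp only [Finset.disjoint_left, mem_expandPoint]
  constructor
  · exact fun h a ha ha' => h (Or.inl ha) (Or.inl ha')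
  · rintro h a (ha | ha) (ha' | ha')
    · exact h ha ha'
    · exact h ha (hT a ha ha'.2 ▸ ha'.1)
    · exact h (hU a ha' ha.2 ▸ ha.1) ha'
    · exact h ha.1 ha'.1

/-- Induction on the number of sets avoiding `y`, a largest one `S` being attached last. No other
set of `F` contains `S`, so its link is the join of the sets of `F` strictly inside `S` with the
sets that contain `S` or are disjoint from it. The latter live on `E` with `S` shrunk to a point
`s`, and are again pointed subsets together with fewer sets avoiding `y`. -/
lemma topAcyclic_union (N n : ℕ) {E : Finset α} {y : α} (F : Finset (Finset α)) (hN : F.card = N)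
    (hy : y ∈ E) (hE : E.card = n + 2) (hF : ∀ S ∈ F, S ⊆ E ∧ y ∉ S ∧ 2 ≤ S.card)
    (hFS : ∀ S ∈ F, TopAcyclic Laminar (F.filter (· ⊂ S)) (S.card - 2)) :
    TopAcyclic Laminar (pointedSubsets E y ∪ F) n := by
  induction N using Nat.strong_induction_on generalizing n E F with
  | _ N ih =>
  rcases F.eq_empty_or_nonempty with rfl | hne
  · rw [Finset.union_empty]
    exact topAcyclic_pointedSubsets n hy hE
  obtain ⟨S, hS, hmax⟩ := Finset.exists_max_image F Finset.card hne
  obtain ⟨hSE, hyS, hS2⟩ := hF S hS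
  obtain ⟨s, hs⟩ : S.Nonempty := by rw [← Finset.card_pos]; omega
  have hmax' : ∀ T ∈ F, S ⊆ T → T = S := fun T hT h =>
    (Finset.eq_of_subset_of_card_le h (hmax T hT)).symm
  have hSlt : S.card < E.card := Finset.card_lt_card
    ⟨hSE, fun h => hyS (h hy)⟩
  have hsE : s ∉ E \ S := by simp [hs]
  have hsy : s ≠ y := by rintro rfl; exact hyS hs
  have hE' : (insert s (E \ S)).card = E.card - S.card + 1 := by
    rw [Finset.card_insert_of_notMem hsE, Finset.card_sdiff_of_subset hSE]
  have hyE' : y ∈ insert s (E \ S) := by simp [hy, hyS]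
  set F' := F.filter (Disjoint S ·) with hF'
  have hdel : TopAcyclic Laminar (pointedSubsets E y ∪ F.erase S) n := by
    refine ih _ ?_ n (F.erase S) rfl hy hE (fun T hT => hF T (Finset.mem_of_mem_erase hT))
      fun T hT => ?_
    · rw [← hN]; exact Finset.card_erase_lt_of_mem hS
    · convert hFS T (Finset.mem_of_mem_erase hT) using 1
      ext U
      simp only [Finset.mem_filter, Finset.mem_erase]
      refine ⟨fun h => ⟨h.1.2, h.2⟩, fun h => ⟨⟨?_, h.1⟩, h.2⟩⟩
      rintro rfl
      exact Finset.ne_of_mem_erase hT (hmax' T (Finset.mem_of_mem_erase hT) h.2.1)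
  have hout : TopAcyclic Laminar (pointedSubsets (insert s (E \ S)) y ∪ F')
      (E.card - S.card - 1) := by
    refine ih _ ?_ _ F' rfl hyE' (by omega) (fun T hT => ?_) fun T hT => ?_
    · rw [← hN]
      refine Finset.card_lt_card ⟨Finset.filter_subset _ _, fun h => ?_⟩
      have := (Finset.mem_filter.1 (h hS)).2
      exact Finset.disjoint_left.1 this hs hs
    · obtain ⟨hT, hd⟩ := Finset.mem_filter.1 hT
      refine ⟨fun a ha => ?_, (hF T hT).2⟩
      exact Finset.mem_insert_of_mem (Finset.mem_sdiff.2
        ⟨(hF T hT).1 ha, fun h => Finset.disjoint_left.1 hd h ha⟩)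
    · obtain ⟨hT, hd⟩ := Finset.mem_filter.1 hT
      convert hFS T hT using 1
      ext U
      simp only [hF', Finset.mem_filter]
      exact ⟨fun h => ⟨h.1.1, h.2⟩, fun h => ⟨⟨h.1, hd.mono_right h.2.1⟩, h.2⟩⟩
  have hpt : ∀ T ∈ pointedSubsets (insert s (E \ S)) y ∪ F', ∀ a ∈ T, a ∈ S → a = s := by
    intro T hT a ha haS
    rcases Finset.mem_union.1 hT with hT | hT
    · have := (mem_pointedSubsets.1 hT).1 ha
      simpa [haS] using this
    · exact absurd ha (Finset.disjoint_left.1 (Finset.mem_filter.1 hT).2 haS)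
  have himg := hout.image (R' := Laminar) (expandPoint S s)
    (fun T hT U hU h => subset_antisymm
      ((expandPoint_subset_iff (hpt T hT)).1 h.subset)
      ((expandPoint_subset_iff (hpt U hU)).1 h.symm.subset))
    (fun T hT U hU => by
      unfold Laminar
      rw [expandPoint_subset_iff (hpt T hT),
        expandPoint_subset_iff (hpt U hU),
        disjoint_expandPoint_iff (hpt T hT) (hpt U hU)])
  set I := (pointedSubsets (insert s (E \ S)) y ∪ F').image (expandPoint S s) with hI
  have hIS : ∀ T ∈ I, S ⊆ T ∨ Disjoint S T := by
    intro T hT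
    obtain ⟨U, hU, rfl⟩ := Finset.mem_image.1 hT
    by_cases h : s ∈ U
    · exact Or.inl fun a ha => mem_expandPoint.2 (Or.inr ⟨h, ha⟩)
    · refine Or.inr (Finset.disjoint_left.2 fun a ha haU => ?_)
      rcases mem_expandPoint.1 haU with haU | haU
      · exact h (hpt U hU a haU ha ▸ haU)
      · exact h haU.1
  have hjoin := (hFS S hS).join himg
    (by
      refine Finset.disjoint_left.2 fun T hT hTI => ?_
      obtain ⟨hTF, hTS⟩ := Finset.mem_filter.1 hT
      rcases hIS T hTI with h | h
      · exact hTS.2 h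
      · have h2 := (hF T hTF).2.2
        obtain ⟨t, ht⟩ : T.Nonempty := by rw [← Finset.card_pos]; omega
        exact Finset.disjoint_left.1 h (hTS.1 ht) ht)
    (by
      intro T hT U hU
      have hTS := (Finset.mem_filter.1 hT).2
      rcases hIS U hU with h | h
      · exact Or.inl (hTS.1.trans h)
      · exact Or.inr (Or.inr (h.mono_left hTS.1)))
  -- Here `n` is positive, since `E` contains `y` besides the at least two elements of `S`. The two
  -- factors of the link then contribute `S.card - 2` and `(E.card - S.card + 1) - 2`, whose sum is
  -- `n - 1`.
  obtain ⟨d, hd⟩ : ∃ d, n = d + 1 := ⟨n - 1, by omega⟩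
  subst hd
  rw [show S.card - 2 + (E.card - S.card - 1) = d by omega] at hjoin
  rw [← Finset.insert_erase hS, Finset.union_insert]
  refine TopAcyclic.insert _ _ d S ?_ ?_ hdel hjoin
  · simp [mem_pointedSubsets, hyS]
  · intro T
    simp only [Finset.mem_union, Finset.mem_filter, Finset.mem_erase]
    constructor
    · rintro (⟨hT, hTS⟩ | hT)
      · exact ⟨Or.inr ⟨hTS.ne, hT⟩, Or.inr (Or.inl hTS.1)⟩
      · refine ⟨?_, by rcases hIS T hT with h | h <;> simp [Laminar, h]⟩
        obtain ⟨U, hU, rfl⟩ := Finset.mem_image.1 hT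
        rcases Finset.mem_union.1 hU with hU' | hU'
        · left
          obtain ⟨h1, h2, h3, h4⟩ := mem_pointedSubsets.1 hU'
          refine mem_pointedSubsets.2 ⟨fun a ha => ?_, mem_expandPoint.2 (Or.inl h2),
            h3.trans (Finset.card_le_card fun a ha => mem_expandPoint.2 (Or.inl ha)),
            fun h => h4 (subset_antisymm h1 fun a ha => ?_)⟩
          · rcases mem_expandPoint.1 ha with ha | ha
            · rcases Finset.mem_insert.1 (h1 ha) with rfl | ha
              · exact hSE hs
              · exact (Finset.mem_sdiff.1 ha).1
            · exact hSE ha.2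
          · rcases Finset.mem_insert.1 ha with rfl | ha
            · rcases mem_expandPoint.1 (h ▸ hSE hs) with h' | h'
              exacts [h', h'.1]
            · obtain ⟨haE, haS⟩ := Finset.mem_sdiff.1 ha
              rcases mem_expandPoint.1 (h ▸ haE) with h' | h'
              exacts [h', absurd h'.2 haS]
        · right
          obtain ⟨hUF, hd⟩ := Finset.mem_filter.1 hU'
          have hsU : s ∉ U := Finset.disjoint_left.1 hd hs
          rw [expandPoint, if_neg hsU]
          refine ⟨?_, hUF⟩
          rintro rfl
          exact hsU hs
    · rintro ⟨hT | ⟨hTS, hT⟩, hlam⟩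
      · right
        obtain ⟨h1, h2, h3, h4⟩ := mem_pointedSubsets.1 hT
        have hlam' : S ⊆ T ∨ Disjoint S T := by
          rcases hlam with h | h | h
          exacts [Or.inl h, absurd (h h2) hyS, Or.inr h]
        rcases hlam' with h | h
        -- Shrinking the block `S` back to `s` inverts the expansion; `s` and `y` guarantee two
        -- elements.
        · refine Finset.mem_image.2 ⟨insert s (T \ S), Finset.mem_union_left _
            (mem_pointedSubsets.2 ⟨Finset.insert_subset_insert _
              (Finset.sdiff_subset_sdiff h1 subset_rfl), by simp [h2, hyS], ?_, fun he => h4 ?_⟩),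
            ?_⟩
          · rw [← Finset.card_pair hsy]
            exact Finset.card_le_card (by simp [Finset.insert_subset_iff, h2, hyS])
          · refine subset_antisymm h1 fun a ha => ?_
            by_cases haS : a ∈ S
            · exact h haS
            · have : a ∈ insert s (T \ S) := by rw [he]; simp [ha, haS]
              rcases Finset.mem_insert.1 this with rfl | this
              · exact h hs
              · exact (Finset.mem_sdiff.1 this).1
          · ext a
            rw [mem_expandPoint]
            simp only [Finset.mem_insert, Finset.mem_sdiff, true_or, true_and]
            constructor
            · rintro ((rfl | ha) | ha)
              exacts [h hs, ha.1, h ha]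
            · tauto
        · have hsT : s ∉ T := Finset.disjoint_left.1 h hs
          refine Finset.mem_image.2 ⟨T, Finset.mem_union_left _
            (mem_pointedSubsets.2 ⟨fun a ha => ?_, h2, h3, ?_⟩), by rw [expandPoint, if_neg hsT]⟩
          · exact Finset.mem_insert_of_mem (Finset.mem_sdiff.2
              ⟨h1 ha, fun haS => Finset.disjoint_left.1 h haS ha⟩)
          · rintro rfl; simp at hsT
      · rcases hlam with h | h | h
        · exact absurd (hmax' T hT h) hTS
        · exact Or.inl ⟨hT, h.ssubset_of_ne hTS⟩
        · right
          have hsT : s ∉ T := Finset.disjoint_left.1 h hs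
          exact Finset.mem_image.2 ⟨T, Finset.mem_union_right _
            (Finset.mem_filter.2 ⟨hT, h⟩), by rw [expandPoint, if_neg hsT]⟩

/-- The set `S` separates two elements of the same colour. -/
def SplitsColour {C : Type*} (c : α → C) (S : Finset α) : Prop := ∃ a ∈ S, ∃ b ∉ S, c a = c b

open Classical in
/-- The proper subsets of `E` with at least two elements which separate two elements of the same
colour. -/
noncomputable def colourSplitting {C : Type*} (c : α → C) (E : Finset α) : Finset (Finset α) :=
  E.powerset.filter fun S => S ≠ E ∧ 2 ≤ S.card ∧ SplitsColour c S

lemma mem_colourSplitting {C : Type*} {c : α → C} {E S : Finset α} :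
    S ∈ colourSplitting c E ↔ S ⊆ E ∧ S ≠ E ∧ 2 ≤ S.card ∧ SplitsColour c S := by
  simp [colourSplitting]

/-- A subset of `E` containing `y` separates `y` from the element `b` outside `E`, so it is
automatically colour-splitting. Any other colour-splitting `S` satisfies the hypothesis on `E`
itself, which is why the statement is made for all colour-splitting `E` and not only for the
complement of one leaf. -/
theorem topAcyclic_colourSplitting {C : Type*} (c : α → C) (n : ℕ) (E : Finset α)
    (hE : E.card = n + 2) (hc : SplitsColour c E) : TopAcyclic Laminar (colourSplitting c E) n := by
  induction n using Nat.strong_induction_on generalizing E with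
  | _ n ih =>
  obtain ⟨y, hy, b, hb, hyb⟩ := hc
  have heq : colourSplitting c E =
      pointedSubsets E y ∪ (colourSplitting c E).filter (y ∉ ·) := by
    ext T
    simp only [Finset.mem_union, Finset.mem_filter, mem_pointedSubsets, mem_colourSplitting]
    constructor
    · tauto
    · rintro (⟨h1, h2, h3, h4⟩ | h)
      · exact ⟨h1, h4, h3, y, h2, b, fun h => hb (h1 h), hyb⟩
      · exact h.1
  rw [heq]
  refine topAcyclic_union _ n _ rfl hy hE (fun S hS => ?_) fun S hS => ?_
  · rw [Finset.mem_filter, mem_colourSplitting] at hS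
    exact ⟨hS.1.1, hS.2, hS.1.2.2.1⟩
  · rw [Finset.mem_filter, mem_colourSplitting] at hS
    obtain ⟨⟨h1, h2, h3, h4⟩, h5⟩ := hS
    have hlt : S.card < E.card := Finset.card_lt_card (h1.ssubset_of_ne h2)
    convert ih (S.card - 2) (by omega) S (by omega) h4 using 1
    ext T
    simp only [Finset.mem_filter, mem_colourSplitting]
    constructor
    · rintro ⟨⟨⟨h6, h7, h8, h9⟩, h10⟩, h11⟩
      exact ⟨h11.1, h11.ne, h8, h9⟩
    · rintro ⟨h6, h7, h8, h9⟩
      exact ⟨⟨⟨h6.trans h1, fun h => h2 (subset_antisymm h1 (h ▸ h6)), h8, h9⟩,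
        fun h => h5 (h6 h)⟩, h6.ssubset_of_ne h7⟩

end Laminar

/-! ### Clique complexes inside the exterior algebra -/

section Exterior

open CliffordAlgebra

variable (K : Type*) [Field K] {V : Type*}

/-- The exterior algebra on the vertices; the simplex with the vertices `v₁, …, vₖ` is the
product `v₁ ∧ ⋯ ∧ vₖ`. -/
abbrev SimplexAlgebra (V : Type*) : Type _ := ExteriorAlgebra K (V →₀ K)

/-- The generator of a vertex. -/
noncomputable def vertexGen (v : V) : SimplexAlgebra K V :=
  ExteriorAlgebra.ι K (Finsupp.single v 1)

/-- The simplex with the given list of vertices. -/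
noncomputable def simplex (l : List V) : SimplexAlgebra K V := (l.map (vertexGen K)).prod

/-- The contraction with a linear form on the span of the vertices. -/
noncomputable def contraction (f : V → K) : SimplexAlgebra K V →ₗ[K] SimplexAlgebra K V :=
  contractLeft (Q := (0 : QuadraticForm K (V →₀ K))) (Finsupp.linearCombination K f)

/-- The boundary map of the augmented simplicial chain complex. -/
noncomputable def boundary (V : Type*) : SimplexAlgebra K V →ₗ[K] SimplexAlgebra K V :=
  contraction K fun _ => 1

variable {K}

lemma contraction_vertexGen_mul (f : V → K) (v : V) (x : SimplexAlgebra K V) :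
    contraction K f (vertexGen K v * x) = f v • x - vertexGen K v * contraction K f x := by
  have := contractLeft_ι_mul (Q := (0 : QuadraticForm K (V →₀ K)))
    (Finsupp.linearCombination K f) (Finsupp.single v 1) x
  rwa [Finsupp.linearCombination_single, one_smul] at this

lemma contraction_one (f : V → K) : contraction K f 1 = 0 :=
  contractLeft_one (Q := (0 : QuadraticForm K (V →₀ K))) _

lemma contraction_comm (f g : V → K) (x : SimplexAlgebra K V) :
    contraction K f (contraction K g x) = -contraction K g (contraction K f x) :=
  contractLeft_comm (Q := (0 : QuadraticForm K (V →₀ K))) _ _ x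

lemma boundary_vertexGen_mul (v : V) (x : SimplexAlgebra K V) :
    boundary K V (vertexGen K v * x) = x - vertexGen K v * boundary K V x := by
  rw [boundary, contraction_vertexGen_mul, one_smul]

lemma boundary_boundary (x : SimplexAlgebra K V) : boundary K V (boundary K V x) = 0 :=
  contractLeft_contractLeft (Q := (0 : QuadraticForm K (V →₀ K))) _ x

lemma vertexGen_mul_self (v : V) : vertexGen K v * vertexGen K v = 0 :=
  ExteriorAlgebra.ι_sq_zero _

lemma vertexGen_mul_comm (v w : V) :
    vertexGen K v * vertexGen K w = -(vertexGen K w * vertexGen K v) :=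
  eq_neg_of_add_eq_zero_left (ExteriorAlgebra.ι_add_mul_swap _ _)

@[simp] lemma simplex_nil : simplex K ([] : List V) = 1 := rfl

@[simp] lemma simplex_cons (v : V) (l : List V) :
    simplex K (v :: l) = vertexGen K v * simplex K l := by simp [simplex]

lemma simplex_perm {l l' : List V} (h : l.Perm l') :
    simplex K l = simplex K l' ∨ simplex K l = -simplex K l' := by
  induction h with
  | nil => simp
  | cons v _ ih => rcases ih with h | h <;> simp [h]
  | swap v w l =>
    right
    rw [simplex_cons, simplex_cons, simplex_cons, simplex_cons, ← mul_assoc, vertexGen_mul_comm,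
      neg_mul, mul_assoc]
  | trans _ _ ih1 ih2 => rcases ih1 with h1 | h1 <;> rcases ih2 with h2 | h2 <;> simp [h1, h2]

lemma vertexGen_mul_simplex_of_mem {v : V} {l : List V} (h : v ∈ l) :
    vertexGen K v * simplex K l = 0 := by
  classical
  rcases simplex_perm (K := K) (List.perm_cons_erase h) with h | h <;>
    simp [h, ← mul_assoc, vertexGen_mul_self]

lemma contraction_simplex_of_forall {f : V → K} {l : List V} (h : ∀ v ∈ l, f v = 0) :
    contraction K f (simplex K l) = 0 := by
  induction l with
  | nil => exact contraction_one f
  | cons v l ih =>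
    rw [simplex_cons, contraction_vertexGen_mul, h v (by simp), zero_smul,
      ih fun w hw => h w (by simp [hw]), mul_zero, sub_zero]

/-- A list of distinct vertices in `W` which are pairwise related by `R`. -/
def IsCliqueList (R : V → V → Prop) (W : Finset V) (l : List V) : Prop :=
  l.Nodup ∧ (∀ v ∈ l, v ∈ W) ∧ ∀ v ∈ l, ∀ w ∈ l, R v w

variable (K) in
/-- The chains spanned by the cliques with `k` vertices. -/
noncomputable def cliqueChain (R : V → V → Prop) (W : Finset V) (k : ℕ) : Submodule K (SimplexAlgebra K V) :=
  Submodule.span K {x | ∃ l, IsCliqueList R W l ∧ l.length = k ∧ x = simplex K l}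

variable {R : V → V → Prop} {W : Finset V} {k : ℕ}

lemma simplex_mem_cliqueChain {l : List V} (h : IsCliqueList R W l) (hk : l.length = k) :
    simplex K l ∈ cliqueChain K R W k := Submodule.subset_span ⟨l, h, hk, rfl⟩

lemma cliqueChain_mono {W' : Finset V} (h : W ⊆ W') : cliqueChain K R W k ≤ cliqueChain K R W' k :=
  Submodule.span_mono fun _ ⟨l, hl, h'⟩ => ⟨l, ⟨hl.1, fun v hv => h (hl.2.1 v hv), hl.2.2⟩, h'⟩

lemma vertexGen_mul_mem_cliqueChain (hrefl : ∀ v, R v v) (hsymm : ∀ v w, R v w → R w v)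
    {L : Finset V} {v : V} (hv : v ∈ W) (hL : ∀ w ∈ L, w ∈ W ∧ R v w) {x : SimplexAlgebra K V}
    (hx : x ∈ cliqueChain K R L k) : vertexGen K v * x ∈ cliqueChain K R W (k + 1) := by
  induction hx using Submodule.span_induction with
  | mem x hx =>
    obtain ⟨l, hl, hk, rfl⟩ := hx
    by_cases h : v ∈ l
    · rw [vertexGen_mul_simplex_of_mem h]; exact Submodule.zero_mem _
    · rw [← simplex_cons]
      refine simplex_mem_cliqueChain ⟨List.nodup_cons.2 ⟨h, hl.1⟩, ?_, ?_⟩ (by simp [hk])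
      · simp only [List.forall_mem_cons]
        exact ⟨hv, fun w hw => (hL w (hl.2.1 w hw)).1⟩
      · have hR : ∀ w ∈ l, R v w := fun w hw => (hL w (hl.2.1 w hw)).2
        simp only [List.forall_mem_cons]
        exact ⟨⟨hrefl v, hR⟩, fun w hw => ⟨hsymm _ _ (hR w hw), hl.2.2 w hw⟩⟩
  | zero => simp
  | add x y _ _ hx hy => rw [mul_add]; exact Submodule.add_mem _ hx hy
  | smul a x _ hx => rw [mul_smul_comm]; exact Submodule.smul_mem _ _ hx

/-- Contraction with the dual form of `v` removes `v` from simplices and kills those without it; it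
serves to extract the coefficient of `v` in a chain. -/
lemma contraction_single_eq_zero [DecidableEq V] {v : V} (hv : v ∉ W) {x : SimplexAlgebra K V}
    (hx : x ∈ cliqueChain K R W k) : contraction K (Pi.single v 1) x = 0 := by
  induction hx using Submodule.span_induction with
  | mem x hx =>
    obtain ⟨l, hl, hk, rfl⟩ := hx
    refine contraction_simplex_of_forall fun w hw => Pi.single_eq_of_ne ?_ _
    rintro rfl
    exact hv (hl.2.1 w hw)
  | zero => simp
  | add x y _ _ hx hy => rw [map_add, hx, hy, add_zero]
  | smul a x _ hx => rw [map_smul, hx, smul_zero]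

lemma exists_decomposition [DecidableEq V] {v : V} {L : Finset V}
    (hL : ∀ w, w ∈ L ↔ w ∈ W ∧ R v w) {x : SimplexAlgebra K V}
    (hx : x ∈ cliqueChain K R (insert v W) (k + 1)) :
    ∃ y ∈ cliqueChain K R W (k + 1), ∃ z ∈ cliqueChain K R L k, x = y + vertexGen K v * z := by
  induction hx using Submodule.span_induction with
  | mem x hx =>
    obtain ⟨l, hl, hk, rfl⟩ := hx
    by_cases h : v ∈ l
    · have hmem : simplex K (l.erase v) ∈ cliqueChain K R L k := by
        refine simplex_mem_cliqueChain ⟨hl.1.erase v, fun w hw => ?_, fun w hw u hu =>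
          hl.2.2 w (List.mem_of_mem_erase hw) u (List.mem_of_mem_erase hu)⟩ ?_
        · obtain ⟨hwv, hw⟩ := hl.1.mem_erase_iff.1 hw
          exact (hL w).2 ⟨Finset.mem_of_mem_insert_of_ne (hl.2.1 w hw) hwv, hl.2.2 v h w hw⟩
        · rw [List.length_erase_of_mem h, hk]; rfl
      rcases simplex_perm (K := K) (List.perm_cons_erase h) with h | h
      · exact ⟨0, Submodule.zero_mem _, _, hmem, by simp [h]⟩
      · exact ⟨0, Submodule.zero_mem _, _, Submodule.neg_mem _ hmem, by simp [h]⟩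
    · refine ⟨simplex K l, simplex_mem_cliqueChain ⟨hl.1, fun w hw => ?_, hl.2.2⟩ hk, 0,
        Submodule.zero_mem _, by simp⟩
      exact Finset.mem_of_mem_insert_of_ne (hl.2.1 w hw) (by rintro rfl; exact h hw)
  | zero => exact ⟨0, Submodule.zero_mem _, 0, Submodule.zero_mem _, by simp⟩
  | add x x' _ _ hx hx' =>
    obtain ⟨y, hy, z, hz, rfl⟩ := hx
    obtain ⟨y', hy', z', hz', rfl⟩ := hx'
    exact ⟨y + y', Submodule.add_mem _ hy hy', z + z', Submodule.add_mem _ hz hz', by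
      rw [mul_add]; abel⟩
  | smul a x _ hx =>
    obtain ⟨y, hy, z, hz, rfl⟩ := hx
    exact ⟨a • y, Submodule.smul_mem _ _ hy, a • z, Submodule.smul_mem _ _ hz, by
      rw [smul_add, mul_smul_comm]⟩

/-- Over a cone, multiplication by the apex is a contracting homotopy. When `v` is attached, a cycle
has the form `y + v ∧ z` with `z` a cycle in the link, so `z = ∂w`. Then `y + w` is a cycle not
involving `v`; if `∂u = y + w`, the chain `u - v ∧ w` bounds the given cycle. -/
theorem TopAcyclic.exact [DecidableEq V] (hrefl : ∀ v, R v v) (hsymm : ∀ v w, R v w → R w v)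
    {d : ℕ} (h : TopAcyclic R W d) (hk : k ≠ d) {x : SimplexAlgebra K V}
    (hx : x ∈ cliqueChain K R W k) (hdx : boundary K V x = 0) :
    ∃ y ∈ cliqueChain K R W (k + 1), boundary K V y = x := by
  induction h generalizing k x with
  | empty =>
    have hbot : cliqueChain K R ∅ k = ⊥ := by
      refine Submodule.span_eq_bot.2 ?_
      rintro _ ⟨l, hl, hlk, rfl⟩
      cases l with
      | nil => exact absurd hlk.symm hk
      | cons v l => simpa using hl.2.1 v (by simp)
    rw [hbot, Submodule.mem_bot] at hx
    exact ⟨0, Submodule.zero_mem _, by simp [hx]⟩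
  | cone W d v hv h =>
    refine ⟨vertexGen K v * x,
      vertexGen_mul_mem_cliqueChain hrefl hsymm hv (fun w hw => ⟨hw, h w hw⟩) hx, ?_⟩
    rw [boundary_vertexGen_mul, hdx, mul_zero, sub_zero]
  | insert W L d v hv hL hW hlink ih1 ih2 =>
    have hLW : L ⊆ W := fun w hw => ((hL w).1 hw).1
    have hvL : v ∉ L := fun h => hv (hLW h)
    obtain _ | j := k
    -- The only clique without vertices is the empty one, which does not involve `v`.
    · have hx' : x ∈ cliqueChain K R W 0 := by
        refine Submodule.span_mono ?_ hx
        rintro _ ⟨l, hl, hlk, rfl⟩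
        obtain rfl := List.length_eq_zero_iff.1 hlk
        exact ⟨[], ⟨List.nodup_nil, by simp, by simp⟩, rfl, rfl⟩
      obtain ⟨y, hy, hyx⟩ := ih1 (by omega) hx' hdx
      exact ⟨y, cliqueChain_mono (Finset.subset_insert _ _) hy, hyx⟩
    obtain ⟨y, hy, z, hz, rfl⟩ := exists_decomposition hL hx
    -- The dual form of `v`, applied to the boundary of `y + v ∧ z`, leaves only `-∂z`.
    have hdz : boundary K V z = 0 := by
      have h1 : contraction K (Pi.single v 1) (boundary K V y) = 0 := by
        rw [boundary, contraction_comm, contraction_single_eq_zero hv hy, map_zero, neg_zero]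
      have h2 : contraction K (Pi.single v 1) (boundary K V z) = 0 := by
        rw [boundary, contraction_comm, contraction_single_eq_zero hvL hz, map_zero, neg_zero]
      have h3 := congrArg (contraction K (Pi.single v 1)) hdx
      rw [map_add, boundary_vertexGen_mul, map_add, map_sub, contraction_vertexGen_mul, h1, h2,
        contraction_single_eq_zero hvL hz, map_zero] at h3
      simpa using h3
    obtain ⟨w, hw, rfl⟩ := ih2 (by omega) hz hdz
    have hd : boundary K V (y + w) = 0 := by
      rw [map_add, boundary_vertexGen_mul, boundary_boundary, mul_zero, sub_zero] at hdx
      rw [map_add, hdx]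
    obtain ⟨u, hu, hud⟩ := ih1 hk (Submodule.add_mem _ hy (cliqueChain_mono hLW hw)) hd
    refine ⟨u - vertexGen K v * w, Submodule.sub_mem _
      (cliqueChain_mono (Finset.subset_insert _ _) hu)
      (vertexGen_mul_mem_cliqueChain hrefl hsymm (Finset.mem_insert_self _ _)
        (fun a ha => ⟨Finset.mem_insert_of_mem (hLW ha), ((hL a).1 ha).2⟩) hw), ?_⟩
    rw [map_sub, hud, boundary_vertexGen_mul]
    abel

end Exterior

/-! ### The splits of the leaves defined by the edges of a tree -/

namespace OrientedTree

variable {r k : ℕ} (T : OrientedTree r k) (x : Fin r)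

/-- The vertices which are separated from the leaf `x` by the edge number `i`. -/
def below (i : Fin k) : Set (Fin (k + 1)) := {v | ¬ (T.removeEdge i).Reachable (T.leg x) v}

open Classical in
/-- The leaves which are separated from the leaf `x` by the edge number `i`. -/
noncomputable def split (i : Fin k) : Finset (Fin r) :=
  Finset.univ.filter fun a => T.leg a ∈ T.below x i

variable {x}

@[simp] lemma mem_split {i : Fin k} {a : Fin r} : a ∈ T.split x i ↔ T.leg a ∈ T.below x i := by
  simp [split]

lemma root_notMem_below (i : Fin k) : T.leg x ∉ T.below x i :=
  fun h => h (SimpleGraph.Reachable.refl _)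

lemma mem_below_congr {i : Fin k} {u v : Fin (k + 1)} (h : (T.removeEdge i).Reachable u v) :
    u ∈ T.below x i ↔ v ∈ T.below x i :=
  not_congr ⟨fun h' => h'.trans h, fun h' => h'.trans h.symm⟩

lemma mem_below_iff_of_edge {i j : Fin k} (hij : j ≠ i) {u v : Fin (k + 1)}
    (h : T.edge j = s(u, v)) : u ∈ T.below x i ↔ v ∈ T.below x i :=
  T.mem_below_congr (SimpleGraph.Adj.reachable ((T.removeEdge_adj _ _ _).2 ⟨j, hij, h⟩))

lemma removeEdge_reachable_or {i : Fin k} {u v : Fin (k + 1)} (h : T.edge i = s(u, v))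
    (w : Fin (k + 1)) : (T.removeEdge i).Reachable u w ∨ (T.removeEdge i).Reachable v w := by
  obtain ⟨p⟩ := T.isTree.connected w u
  have key : ∀ a b, (SimpleGraph.fromEdgeSet (Set.range T.edge)).Walk a b →
      ((T.removeEdge i).Reachable u b ∨ (T.removeEdge i).Reachable v b) →
      ((T.removeEdge i).Reachable u a ∨ (T.removeEdge i).Reachable v a) := by
    intro a b p hb
    induction p with
    | nil => exact hb
    | @cons a a' b hadj _ ih =>
      obtain ⟨⟨l, hl⟩, -⟩ := (SimpleGraph.fromEdgeSet_adj _).1 hadj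
      by_cases hli : l = i
      · subst hli
        rw [h, Sym2.eq_iff] at hl
        rcases hl with ⟨rfl, rfl⟩ | ⟨rfl, rfl⟩
        exacts [Or.inl (SimpleGraph.Reachable.refl _), Or.inr (SimpleGraph.Reachable.refl _)]
      · have hr : (T.removeEdge i).Reachable a' a :=
          (SimpleGraph.Adj.reachable ((T.removeEdge_adj _ _ _).2 ⟨l, hli, hl⟩)).symm
        exact (ih hb).imp (·.trans hr) (·.trans hr)
  exact key _ _ p (Or.inl (SimpleGraph.Reachable.refl _))

lemma removeEdge_not_reachable {i : Fin k} {u v : Fin (k + 1)} (h : T.edge i = s(u, v)) :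
    ¬ (T.removeEdge i).Reachable u v := by
  have hb := (SimpleGraph.isAcyclic_iff_forall_isBridge.1 T.isTree.isAcyclic)
    (show T.edge i ∈ T.graph.edgeSet by rw [T.edgeSet_eq.1]; exact ⟨i, rfl⟩)
  rw [h, SimpleGraph.isBridge_iff, ← h] at hb
  exact hb

variable (x) in
lemma exists_lower_upper (i : Fin k) : ∃ e : Fin (k + 1) × Fin (k + 1),
    T.edge i = s(e.1, e.2) ∧ (∀ w, w ∈ T.below x i ↔ (T.removeEdge i).Reachable e.1 w) ∧
      ∀ w, w ∉ T.below x i ↔ (T.removeEdge i).Reachable e.2 w := by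
  have key : ∀ u v, T.edge i = s(u, v) → (T.removeEdge i).Reachable v (T.leg x) →
      T.edge i = s(u, v) ∧ (∀ w, w ∈ T.below x i ↔ (T.removeEdge i).Reachable u w) ∧
      ∀ w, w ∉ T.below x i ↔ (T.removeEdge i).Reachable v w := by
    intro u v h hv
    have h2 : ∀ w, w ∉ T.below x i ↔ (T.removeEdge i).Reachable v w := fun w => by
      simp only [below, Set.mem_ofPred_eq, not_not]
      exact ⟨fun h' => hv.trans h', fun h' => hv.symm.trans h'⟩
    refine ⟨h, fun w => ?_, h2⟩
    rw [← not_iff_not, h2]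
    refine ⟨fun h' h'' => T.removeEdge_not_reachable h (h''.trans h'.symm), fun h' => ?_⟩
    exact (T.removeEdge_reachable_or h w).resolve_left h'
  obtain ⟨⟨u, v⟩, h⟩ : ∃ e : Fin (k + 1) × Fin (k + 1), T.edge i = s(e.1, e.2) := by
    induction T.edge i with
    | _ u v => exact ⟨(u, v), rfl⟩
  rcases T.removeEdge_reachable_or h (T.leg x) with h' | h'
  · exact ⟨(v, u), key v u (h.trans Sym2.eq_swap) h'⟩
  · exact ⟨(u, v), key u v h h'⟩

variable (x) in
/-- The end of the edge number `i` which is further away from the leaf `x`. -/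
noncomputable def lower (i : Fin k) : Fin (k + 1) := (T.exists_lower_upper x i).choose.1

variable (x) in
/-- The end of the edge number `i` which is closer to the leaf `x`. -/
noncomputable def upper (i : Fin k) : Fin (k + 1) := (T.exists_lower_upper x i).choose.2

variable (x) in
lemma edge_eq (i : Fin k) : T.edge i = s(T.lower x i, T.upper x i) :=
  (T.exists_lower_upper x i).choose_spec.1

lemma mem_below_iff {i : Fin k} {w : Fin (k + 1)} :
    w ∈ T.below x i ↔ (T.removeEdge i).Reachable (T.lower x i) w :=
  (T.exists_lower_upper x i).choose_spec.2.1 w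

lemma notMem_below_iff {i : Fin k} {w : Fin (k + 1)} :
    w ∉ T.below x i ↔ (T.removeEdge i).Reachable (T.upper x i) w :=
  (T.exists_lower_upper x i).choose_spec.2.2 w

lemma lower_mem_below (i : Fin k) : T.lower x i ∈ T.below x i :=
  T.mem_below_iff.2 (SimpleGraph.Reachable.refl _)

lemma upper_notMem_below (i : Fin k) : T.upper x i ∉ T.below x i :=
  T.notMem_below_iff.2 (SimpleGraph.Reachable.refl _)

lemma lower_ne_upper (i : Fin k) : T.lower x i ≠ T.upper x i :=
  fun h => T.upper_notMem_below (x := x) i (h ▸ T.lower_mem_below i)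

lemma lower_mem_below_iff {i j : Fin k} (hij : j ≠ i) :
    T.lower x j ∈ T.below x i ↔ T.upper x j ∈ T.below x i :=
  T.mem_below_iff_of_edge hij (T.edge_eq x j)

lemma removeEdge_reachable_iff {i : Fin k} {u v : Fin (k + 1)} :
    (T.removeEdge i).Reachable u v ↔ (u ∈ T.below x i ↔ v ∈ T.below x i) := by
  refine ⟨T.mem_below_congr, fun h => ?_⟩
  by_cases hu : u ∈ T.below x i
  · exact (T.mem_below_iff.1 hu).symm.trans (T.mem_below_iff.1 (h.1 hu))
  · exact (T.notMem_below_iff.1 hu).symm.trans (T.notMem_below_iff.1 fun hv => hu (h.2 hv))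

/-- The edge `j` does not separate two vertices which lie on the other side of the edge `i`. -/
lemma mem_below_iff_mem_below {i j : Fin k} (hij : j ≠ i) {u v : Fin (k + 1)}
    (hu : ¬ (u ∈ T.below x i ↔ T.upper x j ∈ T.below x i))
    (hv : ¬ (v ∈ T.below x i ↔ T.upper x j ∈ T.below x i)) :
    u ∈ T.below x j ↔ v ∈ T.below x j := by
  obtain ⟨p⟩ := (T.removeEdge_reachable_iff (x := x) (i := i) (u := u) (v := v)).2 (by tauto)
  induction p with
  | nil => rfl
  | @cons u u' v h _ ih =>
    obtain ⟨l, hl, he⟩ := (T.removeEdge_adj _ _ _).1 h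
    have h1 := T.mem_below_iff_of_edge (x := x) hl he
    have hlj : l ≠ j := by
      rintro rfl
      have h2 := T.lower_mem_below_iff (x := x) hl
      have h3 := T.edge_eq x l
      rw [he, Sym2.eq_iff] at h3
      rcases h3 with ⟨rfl, rfl⟩ | ⟨rfl, rfl⟩ <;> tauto
    rw [T.mem_below_iff_of_edge (x := x) hlj he]
    exact ih (by rwa [← h1]) hv

lemma below_subset_of_upper_mem {i j : Fin k} (hij : j ≠ i) (h : T.upper x j ∈ T.below x i) :
    T.below x j ⊆ T.below x i := by
  intro v hv
  by_contra hvi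
  exact T.root_notMem_below j ((T.mem_below_iff_mem_below hij (u := T.leg x) (v := v)
    (by simp [h, T.root_notMem_below]) (by simp [h, hvi])).2 hv)

lemma below_subset_of_lower_mem {i j : Fin k} (h : T.lower x i ∈ T.below x j) :
    T.below x i ⊆ T.below x j := by
  rcases eq_or_ne i j with rfl | hij
  · exact subset_rfl
  · exact T.below_subset_of_upper_mem hij ((T.lower_mem_below_iff hij).1 h)

lemma disjoint_below {i j : Fin k} (h : T.lower x i ∉ T.below x j)
    (h' : T.lower x j ∉ T.below x i) : Disjoint (T.below x i) (T.below x j) := by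
  have hij : j ≠ i := by rintro rfl; exact h (T.lower_mem_below j)
  rw [T.lower_mem_below_iff hij] at h'
  refine Set.disjoint_left.2 fun v hv hv' => h ?_
  exact (T.mem_below_iff_mem_below hij (by simp [h', T.lower_mem_below]) (by simp [h', hv])).2 hv'

lemma not_lower_mem_and {i j : Fin k} (hij : i ≠ j) (h : T.lower x i ∈ T.below x j)
    (h' : T.lower x j ∈ T.below x i) : False :=
  T.upper_notMem_below i (T.below_subset_of_lower_mem h' ((T.lower_mem_below_iff hij).1 h))

lemma lower_injective : Function.Injective (T.lower x) := by
  intro i j h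
  by_contra hij
  exact T.not_lower_mem_and hij (h ▸ T.lower_mem_below j) (h ▸ T.lower_mem_below i)

variable (x) in
lemma eq_root_or_exists_lower (v : Fin (k + 1)) : v = T.leg x ∨ ∃ i, v = T.lower x i := by
  by_contra! hv
  -- Otherwise `v`, the root vertex and the `k` lower ends would be `k + 2` distinct vertices.
  have hinj : Function.Injective (fun o : Option (Option (Fin k)) =>
      o.elim v fun o => o.elim (T.leg x) (T.lower x)) := by
    have hroot : ∀ i, T.leg x ≠ T.lower x i := fun i h =>
      T.root_notMem_below i (h ▸ T.lower_mem_below (x := x) i)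
    rintro (_ | _ | i) (_ | _ | j) h <;> simp only [Option.elim] at h
    · rfl
    · exact absurd h hv.1
    · exact absurd h (hv.2 j)
    · exact absurd h.symm hv.1
    · rfl
    · exact absurd h (hroot j)
    · exact absurd h.symm (hv.2 i)
    · exact absurd h.symm (hroot i)
    · rw [T.lower_injective h]
  have := Fintype.card_le_of_injective _ hinj
  simp at this

/-! ### Counting valences -/

-- Each edge is counted once at each of its two distinct ends. Separating lower from upper ends is
-- what makes the counts below work, because lower ends are distinct for distinct edges.
open Classical in
lemma sum_valence (B : Finset (Fin (k + 1))) : ∑ v ∈ B, T.valence v =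
    (Finset.univ.filter fun i => T.lower x i ∈ B).card +
    (Finset.univ.filter fun i => T.upper x i ∈ B).card +
    (Finset.univ.filter fun a => T.leg a ∈ B).card := by
  have hedge : ∀ v i, (if v ∈ T.edge i then 1 else 0) =
      (if T.lower x i = v then 1 else 0) + if T.upper x i = v then 1 else 0 := by
    intro v i
    have := T.lower_ne_upper (x := x) i
    have hmem : v ∈ T.edge i ↔ v = T.lower x i ∨ v = T.upper x i := by
      rw [T.edge_eq x i, Sym2.mem_iff]
    split_ifs <;> grind
  have hcount : ∀ {n : ℕ} (f : Fin n → Fin (k + 1)),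
      ∑ v ∈ B, (Finset.univ.filter fun i => f i = v).card =
        (Finset.univ.filter fun i => f i ∈ B).card := by
    intro n f
    simp only [Finset.card_filter]
    rw [Finset.sum_comm]
    exact Finset.sum_congr rfl fun i _ => Finset.sum_ite_eq B (f i) _
  rw [← hcount, ← hcount, ← hcount, ← Finset.sum_add_distrib, ← Finset.sum_add_distrib]
  refine Finset.sum_congr rfl fun v _ => ?_
  unfold valence valenceOf
  congr 1
  simp only [Finset.card_filter, ← Finset.sum_add_distrib]
  refine Finset.sum_congr rfl fun i _ => ?_
  convert hedge v i

lemma sum_valence_univ (hr : 0 < r) : ∑ v, T.valence v = 2 * k + r := by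
  rw [T.sum_valence (x := ⟨0, hr⟩)]
  simp; ring

open Classical in
lemma three_mul_card_le (B : Finset (Fin (k + 1))) : 3 * B.card ≤
    (Finset.univ.filter fun i => T.lower x i ∈ B).card +
    (Finset.univ.filter fun i => T.upper x i ∈ B).card +
    (Finset.univ.filter fun a => T.leg a ∈ B).card := by
  rw [← T.sum_valence, mul_comm, ← smul_eq_mul, ← Finset.sum_const]
  exact Finset.sum_le_sum fun v _ => T.three_le v

open Classical in
lemma card_lower_le (B : Finset (Fin (k + 1))) :
    (Finset.univ.filter fun i => T.lower x i ∈ B).card ≤ B.card :=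
  Finset.card_le_card_of_injOn (T.lower x) (by intro i; simp) T.lower_injective.injOn

/-- Let `B` be the set of vertices below `i`. It contains at most `B.card` lower ends, and fewer
upper ends than lower ends, since `i` enters `B` only by its lower end. Trivalence leaves at least
`B.card + 1` legs. -/
lemma two_le_card_split (i : Fin k) : 2 ≤ (T.split x i).card := by
  classical
  set B := Finset.univ.filter (· ∈ T.below x i) with hB
  have h1 := T.three_mul_card_le (x := x) B
  have h2 := T.card_lower_le (x := x) B
  have h3 : (Finset.univ.filter fun j => T.upper x j ∈ B) ⊂
      Finset.univ.filter fun j => T.lower x j ∈ B := by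
    refine Finset.ssubset_iff_of_subset (fun j hj => ?_) |>.2 ⟨i, ?_, ?_⟩
    · simp only [hB, Finset.mem_filter, Finset.mem_univ, true_and] at hj ⊢
      refine (T.lower_mem_below_iff ?_).2 hj
      rintro rfl
      exact T.upper_notMem_below j hj
    · simp [hB, T.lower_mem_below]
    · simp [hB, T.upper_notMem_below]
  have h4 := Finset.card_lt_card h3
  have h5 : (Finset.univ.filter fun a => T.leg a ∈ B) = T.split x i := by
    ext a; simp [hB]
  have h6 : 0 < B.card := Finset.card_pos.2 ⟨_, by simpa [hB] using T.lower_mem_below (x := x) i⟩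
  rw [h5] at h1
  omega

/-- The same count on the side of the root: the root vertex is not a lower end, so there are at most
`B.card - 1` lower ends, and `i` accounts for at most one extra upper end. Again at least `B.card +
1` legs remain. -/
lemma card_split_add_two_le (i : Fin k) : (T.split x i).card + 2 ≤ r := by
  classical
  set B := Finset.univ.filter (· ∉ T.below x i) with hB
  have h1 := T.three_mul_card_le (x := x) B
  have h2 : (Finset.univ.filter fun j => T.lower x j ∈ B).card ≤ (B.erase (T.leg x)).card := by
    refine Finset.card_le_card_of_injOn (T.lower x) (fun j => ?_) T.lower_injective.injOn
    simp only [Finset.coe_filter, Set.mem_ofPred_eq, Finset.mem_univ, true_and, Finset.coe_erase]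
    refine fun h => ⟨h, fun h' => T.root_notMem_below (x := x) j ?_⟩
    rw [Set.mem_singleton_iff] at h'
    exact h' ▸ T.lower_mem_below (x := x) j
  have hroot : T.leg x ∈ B := by simp [hB, T.root_notMem_below]
  rw [Finset.card_erase_of_mem hroot] at h2
  have h3 : (Finset.univ.filter fun j => T.upper x j ∈ B) ⊆
      insert i (Finset.univ.filter fun j => T.lower x j ∈ B) := by
    intro j hj
    by_cases hji : j = i
    · simp [hji]
    · simp only [hB, Finset.mem_insert, Finset.mem_filter, Finset.mem_univ, true_and] at hj ⊢
      exact Or.inr (by rwa [T.lower_mem_below_iff hji])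
  have h4 := (Finset.card_le_card h3).trans (Finset.card_insert_le _ _)
  have h5 : (Finset.univ.filter fun a => T.leg a ∈ B) = (T.split x i)ᶜ := by
    ext a; simp [hB]
  have h6 : 0 < B.card := Finset.card_pos.2 ⟨_, hroot⟩
  have h7 := Finset.card_compl_add_card (T.split x i)
  rw [Fintype.card_fin] at h7
  rw [h5] at h1
  omega

/-- The count for the region below `i` but not below `j`: it loses the upper end of `i` and gains
that of `j`, so lower and upper ends are each at most `B.card` in number and some leg remains. -/
lemma exists_leg_of_below_subset {i j : Fin k} (hj : T.below x j ⊆ T.below x i)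
    (hi : T.lower x i ∉ T.below x j) : ∃ a ∈ T.split x i, a ∉ T.split x j := by
  classical
  set B := Finset.univ.filter (fun v => v ∈ T.below x i ∧ v ∉ T.below x j) with hB
  have h1 := T.three_mul_card_le (x := x) B
  have h2 := T.card_lower_le (x := x) B
  have h3 : (Finset.univ.filter fun l => T.upper x l ∈ B) ⊆
      insert j ((Finset.univ.filter fun l => T.lower x l ∈ B).erase i) := by
    intro l hl
    simp only [hB, Finset.mem_insert, Finset.mem_filter, Finset.mem_univ, true_and,
      Finset.mem_erase] at hl ⊢
    by_cases hlj : l = j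
    · exact Or.inl hlj
    · have hli : l ≠ i := by rintro rfl; exact T.upper_notMem_below l hl.1
      rw [T.lower_mem_below_iff hli, T.lower_mem_below_iff hlj]
      exact Or.inr ⟨hli, hl⟩
  have hiB : T.lower x i ∈ B := by simp [hB, hi, T.lower_mem_below]
  have h4 := (Finset.card_le_card h3).trans (Finset.card_insert_le _ _)
  rw [Finset.card_erase_of_mem (by simpa using hiB)] at h4
  have h6 : 0 < B.card := Finset.card_pos.2 ⟨_, hiB⟩
  have h7 : 0 < (Finset.univ.filter fun l => T.lower x l ∈ B).card :=
    Finset.card_pos.2 ⟨i, by simpa using hiB⟩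
  obtain ⟨a, ha⟩ : (Finset.univ.filter fun a => T.leg a ∈ B).Nonempty := by
    rw [← Finset.card_pos]; omega
  exact ⟨a, by simpa [hB] using ha⟩

/-! ### Trees are determined by their splits -/

/-- If `i` is not below `j`, then either `j` is below `i`, and a leg lies between them, or the two
sides are disjoint, and the nonempty split of `i` is not inside that of `j`. Hence the tree order on
edges can be read off from the splits. -/
lemma lower_mem_below_iff_split_subset {i j : Fin k} :
    T.lower x i ∈ T.below x j ↔ T.split x i ⊆ T.split x j := by
  constructor
  · intro h a
    simpa using fun h' => T.below_subset_of_lower_mem h h'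
  · intro h
    by_contra hi
    by_cases hj : T.lower x j ∈ T.below x i
    · obtain ⟨a, ha, ha'⟩ := T.exists_leg_of_below_subset (T.below_subset_of_lower_mem hj) hi
      exact ha' (h ha)
    · obtain ⟨a, ha⟩ : (T.split x i).Nonempty := by
        rw [← Finset.card_pos]; have := T.two_le_card_split (x := x) i; omega
      exact Set.disjoint_left.1 (T.disjoint_below hi hj) (T.mem_split.1 ha)
        (T.mem_split.1 (h ha))

lemma split_injective : Function.Injective (T.split x) := by
  intro i j h
  by_contra hij
  exact T.not_lower_mem_and hij (T.lower_mem_below_iff_split_subset.2 h.subset)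
    (T.lower_mem_below_iff_split_subset.2 h.symm.subset)

lemma laminar_split (i j : Fin k) : Laminar (T.split x i) (T.split x j) := by
  by_cases hi : T.lower x i ∈ T.below x j
  · exact Or.inl (T.lower_mem_below_iff_split_subset.1 hi)
  by_cases hj : T.lower x j ∈ T.below x i
  · exact Or.inr (Or.inl (T.lower_mem_below_iff_split_subset.1 hj))
  refine Or.inr (Or.inr (Finset.disjoint_left.2 fun a ha ha' => ?_))
  exact Set.disjoint_left.1 (T.disjoint_below hi hj) (T.mem_split.1 ha) (T.mem_split.1 ha')

lemma root_notMem_split (i : Fin k) : x ∉ T.split x i := by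
  simpa using T.root_notMem_below i

variable (x) in
lemma vertex_ext {u v : Fin (k + 1)} (h : ∀ i, u ∈ T.below x i ↔ v ∈ T.below x i) : u = v := by
  rcases T.eq_root_or_exists_lower x u with rfl | ⟨i, rfl⟩ <;>
    rcases T.eq_root_or_exists_lower x v with rfl | ⟨j, rfl⟩
  · rfl
  · exact absurd ((h j).2 (T.lower_mem_below j)) (T.root_notMem_below j)
  · exact absurd ((h i).1 (T.lower_mem_below i)) (T.root_notMem_below i)
  · by_contra hij
    exact T.not_lower_mem_and (fun h' => hij (congrArg _ h')) ((h j).2 (T.lower_mem_below j))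
      ((h i).1 (T.lower_mem_below i))

/-- A vertex is determined by the edges below which it lies (`vertex_ext`), and for lower ends this
is inclusion of splits. Matching vertices by these data gives the isomorphism. -/
lemma exists_isIso {T T' : OrientedTree r k} {σ : Equiv.Perm (Fin k)}
    (h : ∀ i, T'.split x (σ i) = T.split x i) : ∃ φ, T.IsIso T' φ σ := by
  have hlower : ∀ i j, T.lower x i ∈ T.below x j ↔ T'.lower x (σ i) ∈ T'.below x (σ j) := by
    intro i j
    rw [lower_mem_below_iff_split_subset, lower_mem_below_iff_split_subset, h, h]
  have hex : ∀ v, ∃ v', ∀ i, v ∈ T.below x i ↔ v' ∈ T'.below x (σ i) := by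
    intro v
    rcases T.eq_root_or_exists_lower x v with rfl | ⟨i, rfl⟩
    · exact ⟨T'.leg x, fun i => by simp [root_notMem_below]⟩
    · exact ⟨T'.lower x (σ i), hlower i⟩
  choose f hf using hex
  have hfinj : Function.Injective f := fun u v huv =>
    T.vertex_ext x fun i => by rw [hf, hf, huv]
  have hext : ∀ {v v'}, (∀ i, v ∈ T.below x i ↔ v' ∈ T'.below x (σ i)) → v' = f v := by
    intro v v' hv
    refine T'.vertex_ext x fun i => ?_
    rw [← σ.apply_symm_apply i, ← hv, hf]
  refine ⟨Equiv.ofBijective f (Finite.injective_iff_bijective.1 hfinj), fun a => ?_, fun i => ?_⟩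
  · refine hext fun i => ?_
    rw [← mem_split, ← mem_split, h]
  · have h1 : T'.lower x (σ i) = f (T.lower x i) := hext (hlower i)
    have h2 : T'.upper x (σ i) = f (T.upper x i) := by
      refine hext fun j => ?_
      by_cases hij : i = j
      · subst hij; simp [upper_notMem_below]
      · rw [← T.lower_mem_below_iff hij, hlower,
          T'.lower_mem_below_iff fun h => hij (σ.injective h)]
    rw [T'.edge_eq x, T.edge_eq x, h1, h2]
    rfl

lemma split_eq_of_isIso {T T' : OrientedTree r k} {φ : Equiv.Perm (Fin (k + 1))}
    {σ : Equiv.Perm (Fin k)} (h : T.IsIso T' φ σ) (i : Fin k) :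
    T'.split x (σ i) = T.split x i := by
  have hadj : ∀ u v, (T'.removeEdge (σ i)).Adj (φ u) (φ v) ↔ (T.removeEdge i).Adj u v := by
    intro u v
    rw [removeEdge_adj, removeEdge_adj, ← σ.exists_congr_right]
    refine exists_congr fun l => ?_
    rw [σ.injective.ne_iff, h.2, ← Sym2.map_mk, (Sym2.map.injective φ.injective).eq_iff]
  let e : T.removeEdge i ≃g T'.removeEdge (σ i) := ⟨φ, @fun u v => hadj u v⟩
  ext a
  rw [mem_split, mem_split, below, below, Set.mem_ofPred_eq, Set.mem_ofPred_eq, h.1, h.1]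
  exact not_congr e.reachable_iff

/-! ### Bridges and contractions in terms of splits -/

lemma isBridgeless_iff {C : Type*} {c : Fin r → C} :
    T.IsBridgeless c ↔ ∀ i, SplitsColour c (T.split x i) := by
  refine forall_congr' fun i => ?_
  simp only [IsBridge, T.removeEdge_reachable_iff (x := x), ← mem_split, SplitsColour]
  push Not
  constructor
  · rintro ⟨a, b, h | h, hab⟩
    · exact ⟨a, h.1, b, h.2, hab⟩
    · exact ⟨b, h.2, a, h.1, hab.symm⟩
  · rintro ⟨a, ha, b, hb, hab⟩
    exact ⟨a, b, Or.inl ⟨ha, hb⟩, hab⟩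

lemma contract_removeEdge_reachable_iff (T : OrientedTree r (k + 1)) (i : Fin (k + 1)) (j : Fin k)
    (u v : Fin (k + 2)) :
    ((T.contract i).removeEdge j).Reachable (T.collapse i u) (T.collapse i v) ↔
      (T.removeEdge (i.succAbove j)).Reachable u v := by
  constructor
  · have fib : ∀ x y : Fin (k + 2), T.collapse i x = T.collapse i y →
        (T.removeEdge (i.succAbove j)).Reachable x y := by
      intro x y hxy
      rcases (T.collapse_eq_iff i x y).1 hxy with rfl | h
      · exact SimpleGraph.Reachable.refl _
      · exact SimpleGraph.Adj.reachable
          ((T.removeEdge_adj _ _ _).2 ⟨i, (Fin.succAbove_ne i j).symm, h⟩)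
    have key : ∀ u' v', ((T.contract i).removeEdge j).Reachable u' v' → ∀ u v,
        T.collapse i u = u' → T.collapse i v = v' →
          (T.removeEdge (i.succAbove j)).Reachable u v := by
      rintro u' v' ⟨w⟩
      induction w with
      | nil => exact fun u v hu hv => fib u v (hu.trans hv.symm)
      | cons h _ ih =>
        intro u v hu hv
        obtain ⟨l, hl, he⟩ := ((T.contract i).removeEdge_adj _ _ _).1 h
        change (T.edge (i.succAbove l)).map (T.collapse i) = _ at he
        revert he
        induction hpq : T.edge (i.succAbove l) with
        | _ p q =>
        intro he
        have hl' : i.succAbove l ≠ i.succAbove j := fun h => hl (Fin.succAbove_right_injective h)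
        have hadj : (T.removeEdge (i.succAbove j)).Reachable p q :=
          SimpleGraph.Adj.reachable ((T.removeEdge_adj _ _ _).2 ⟨_, hl', hpq⟩)
        rw [Sym2.map_mk, Sym2.eq_iff] at he
        rcases he with ⟨h1, h2⟩ | ⟨h1, h2⟩
        · exact (fib u p (hu.trans h1.symm)).trans (hadj.trans (ih q v h2 hv))
        · exact (fib u q (hu.trans h2.symm)).trans (hadj.symm.trans (ih p v h1 hv))
    exact fun h => key _ _ h u v rfl rfl
  · rintro ⟨w⟩
    induction w with
    | nil => exact SimpleGraph.Reachable.refl _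
    | cons h _ ih =>
      refine SimpleGraph.Reachable.trans ?_ ih
      obtain ⟨l, hl, he⟩ := (T.removeEdge_adj _ _ _).1 h
      by_cases hli : l = i
      · subst hli
        rw [(T.collapse_eq_iff l _ _).2 (Or.inr he)]
      · obtain ⟨l, rfl⟩ := Fin.exists_succAbove_eq hli
        refine SimpleGraph.Adj.reachable (((T.contract i).removeEdge_adj _ _ _).2 ⟨l, ?_, ?_⟩)
        · rintro rfl; exact hl rfl
        · change (T.edge (i.succAbove l)).map (T.collapse i) = _
          rw [he, Sym2.map_mk]

lemma split_contract (T : OrientedTree r (k + 1)) (i : Fin (k + 1)) (j : Fin k) :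
    (T.contract i).split x j = T.split x (i.succAbove j) := by
  ext a
  rw [mem_split, mem_split]
  exact not_congr (T.contract_removeEdge_reachable_iff i j _ _)

end OrientedTree

/-! ### Trees with prescribed splits -/

section Existence

variable {α ι : Type*}

lemma Laminar.subset_or_subset {A B : Finset α} (h : Laminar A B) {a : α} (hA : a ∈ A)
    (hB : a ∈ B) : A ⊆ B ∨ B ⊆ A := by
  rcases h with h | h | h
  exacts [Or.inl h, Or.inr h, absurd hB (Finset.disjoint_left.1 h hA)]

/-- Laminar sets with the common element `a` form a chain, so one of least cardinality is contained
in all others. -/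
lemma exists_least_of_laminar [Finite ι] (S : ι → Finset α) (hS : ∀ i j, Laminar (S i) (S j))
    (p : ι → Prop) (a : α) (ha : ∀ i, p i → a ∈ S i) (hp : ∃ i, p i) :
    ∃ i, p i ∧ ∀ j, p j → S i ⊆ S j := by
  classical
  cases nonempty_fintype ι
  obtain ⟨i₀, hi₀⟩ := hp
  obtain ⟨i, hi, hmin⟩ := Finset.exists_min_image (Finset.univ.filter p) (fun i => (S i).card)
    ⟨i₀, by simpa using hi₀⟩
  have hi' : p i := by simpa using hi
  refine ⟨i, hi', fun j hj => ?_⟩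
  rcases (hS i j).subset_or_subset (ha i hi') (ha j hj) with h | h
  · exact h
  · exact (Finset.eq_of_subset_of_card_le h (hmin j (by simpa using hj))).symm.subset

/-- The combinatorial data of a rooted tree: the vertices carry the laminar sets `S v` of leaves,
`par i` is the parent of the vertex `i.succ` and `leg a` is the vertex which carries the leaf `a`. -/
structure IsRootedTree {r k : ℕ} (x : Fin r) (S : Fin (k + 1) → Finset (Fin r))
    (par : Fin k → Fin (k + 1)) (leg : Fin r → Fin (k + 1)) : Prop where
  injective : Function.Injective S
  zero : S 0 = Finset.univ.erase x
  two_le : ∀ v, 2 ≤ (S v).card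
  ssubset_par : ∀ i, S i.succ ⊂ S (par i)
  par_subset : ∀ i v, S i.succ ⊂ S v → S (par i) ⊆ S v
  leg_root : leg x = 0
  mem_leg : ∀ a, a ≠ x → a ∈ S (leg a)
  leg_subset : ∀ a v, a ∈ S v → S (leg a) ⊆ S v

/-- The complement of `x` is added as the root. The parent of a set is the least set strictly
containing it; a leaf `a ≠ x` sits at the least set containing it. The bound `r - 2` says that no
given set equals the root set. -/
lemma exists_isRootedTree {r k : ℕ} (hr : 3 ≤ r) (x : Fin r) (S : Fin k → Finset (Fin r))
    (hinj : Function.Injective S) (hx : ∀ i, x ∉ S i) (h2 : ∀ i, 2 ≤ (S i).card)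
    (hr2 : ∀ i, (S i).card + 2 ≤ r) (hS : ∀ i j, Laminar (S i) (S j)) :
    ∃ par leg, IsRootedTree x (Fin.cons (Finset.univ.erase x) S : Fin (k + 1) → _) par leg := by
  set S' : Fin (k + 1) → Finset (Fin r) := Fin.cons (Finset.univ.erase x) S
  have h0 : S' 0 = Finset.univ.erase x := rfl
  have hcard0 : (S' 0).card = r - 1 := by
    rw [h0, Finset.card_erase_of_mem (Finset.mem_univ _), Finset.card_univ, Fintype.card_fin]
  have hne0 : ∀ i, S i ≠ S' 0 := fun i h => by
    have := hr2 i
    rw [h, hcard0] at this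
    omega
  have hsub0 : ∀ v, S' v ⊆ S' 0 := by
    intro v
    refine Fin.cases subset_rfl (fun i a ha => ?_) v
    rw [h0, Finset.mem_erase]
    refine ⟨?_, Finset.mem_univ _⟩
    rintro rfl
    exact hx i ha
  have hxS' : ∀ v, x ∉ S' v := fun v h => by
    have := hsub0 v h
    rw [h0] at this
    simp at this
  have hinj' : Function.Injective S' := by
    intro u v
    exact Fin.cases (Fin.cases (fun _ => rfl) (fun j h => absurd h.symm (hne0 j)) v)
      (fun i => Fin.cases (fun h => absurd h (hne0 i)) (fun j h => congrArg Fin.succ (hinj h)) v) u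
  have h2' : ∀ v, 2 ≤ (S' v).card := by
    intro v
    refine Fin.cases (by omega) h2 v
  have hlam : ∀ u v, Laminar (S' u) (S' v) := by
    intro u v
    refine Fin.cases (Or.inr (Or.inl (hsub0 v))) (fun i => Fin.cases (Or.inl (hsub0 _))
      (fun j => hS i j) v) u
  have hpar : ∀ i : Fin k, ∃ p, S' i.succ ⊂ S' p ∧ ∀ v, S' i.succ ⊂ S' v → S' p ⊆ S' v := by
    intro i
    obtain ⟨a, ha⟩ : (S i).Nonempty := by rw [← Finset.card_pos]; have := h2 i; omega
    exact exists_least_of_laminar S' hlam (fun v => S' i.succ ⊂ S' v) a (fun v hv => hv.1 ha)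
      ⟨0, (hsub0 _).ssubset_of_ne (hne0 i)⟩
  have hleg : ∀ a, ∃ w, (a = x → w = 0) ∧ (a ≠ x → a ∈ S' w) ∧ ∀ v, a ∈ S' v → S' w ⊆ S' v := by
    intro a
    by_cases hax : a = x
    · subst hax
      exact ⟨0, fun _ => rfl, fun h => absurd rfl h, fun v hv => absurd hv (hxS' v)⟩
    · obtain ⟨w, hw, hmin⟩ := exists_least_of_laminar S' hlam (fun v => a ∈ S' v) a
        (fun v hv => hv) ⟨0, by rw [h0]; simp [hax]⟩
      exact ⟨w, fun h => absurd h hax, fun _ => hw, hmin⟩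
  choose par hpar1 hpar2 using hpar
  choose leg hleg1 hleg2 hleg3 using hleg
  exact ⟨par, leg, hinj', h0, h2', hpar1, hpar2, hleg1 x rfl, hleg2, hleg3⟩

namespace IsRootedTree

variable {r k : ℕ} {x : Fin r} {S : Fin (k + 1) → Finset (Fin r)} {par : Fin k → Fin (k + 1)}
  {leg : Fin r → Fin (k + 1)} (h : IsRootedTree x S par leg)

include h

lemma par_ne (i : Fin k) : par i ≠ i.succ := fun hi => (h.ssubset_par i).ne (by rw [hi])

lemma subset_zero (v : Fin (k + 1)) : S v ⊆ S 0 := by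
  by_cases hv : v = 0
  · rw [hv]
  obtain ⟨i, rfl⟩ := Fin.exists_succ_eq.2 hv
  rw [h.zero]
  intro a ha
  refine Finset.mem_erase.2 ⟨?_, Finset.mem_univ _⟩
  rintro rfl
  -- If `x` (now called `a`) were in a non-root set, that set would contain the root set, where `x`
  -- sits, hence all leaves, and could not be strictly inside its parent.
  have h1 := h.leg_subset a _ ha
  rw [h.leg_root] at h1
  refine (h.ssubset_par i).2 fun b _ => ?_
  by_cases hba : b = a
  · rwa [hba]
  · exact h1 (by rw [h.zero]; simp [hba])

lemma notMem (v : Fin (k + 1)) : x ∉ S v := fun hx => by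
  have := h.subset_zero v hx
  rw [h.zero] at this
  simp at this

/-- A property of the vertices holds if it holds for the root and is inherited from the parents. -/
lemma induction {p : Fin (k + 1) → Prop} (h0 : p 0) (hp : ∀ i, p (par i) → p i.succ)
    (v : Fin (k + 1)) : p v := by
  induction hn : r - (S v).card using Nat.strong_induction_on generalizing v with
  | _ n ih =>
  by_cases hv : v = 0
  · rw [hv]; exact h0
  obtain ⟨i, rfl⟩ := Fin.exists_succ_eq.2 hv
  have h1 := Finset.card_lt_card (h.ssubset_par i)
  have h2 := Finset.card_le_univ (S (par i))
  rw [Fintype.card_fin] at h2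
  exact hp i (ih _ (by omega) _ rfl)

lemma isTree : (SimpleGraph.fromEdgeSet (Set.range fun i => s(i.succ, par i))).IsTree := by
  set G := SimpleGraph.fromEdgeSet (Set.range fun i => s(i.succ, par i))
  have hadj : ∀ i, G.Adj (par i) i.succ := fun i =>
    (SimpleGraph.fromEdgeSet_adj _).2 ⟨⟨i, Sym2.eq_swap⟩, h.par_ne i⟩
  have hreach : ∀ v, G.Reachable 0 v :=
    h.induction (SimpleGraph.Reachable.refl _) fun i hi => hi.trans (hadj i).reachable
  have hconn : G.Connected := by
    refine (SimpleGraph.connected_iff _).2 ⟨fun u v => (hreach u).symm.trans (hreach v),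
      inferInstance⟩
  refine SimpleGraph.isTree_iff_connected_and_card.2 ⟨hconn, le_antisymm ?_ ?_⟩
  · have h1 : Nat.card G.edgeSet ≤ k := by
      refine le_trans ?_ (OrientedTree.nat_card_range_le fun i => s(i.succ, par i))
      rw [Nat.card_coe_set_eq, Nat.card_coe_set_eq]
      exact Set.ncard_le_ncard (OrientedTree.fromEdgeSet_edgeSet_subset _)
    simpa using h1
  · exact hconn.card_vert_le_card_edgeSet_add_one

lemma leg_eq_or_exists_child {v : Fin (k + 1)} {a : Fin r} (ha : a ∈ S v) :
    leg a = v ∨ ∃ i, par i = v ∧ a ∈ S i.succ := by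
  refine or_iff_not_imp_left.2 fun hleg => ?_
  have hax : a ≠ x := by rintro rfl; exact h.notMem v ha
  have key : ∀ w, a ∈ S w → S w ⊂ S v → ∃ i, par i = v ∧ a ∈ S i.succ := by
    refine h.induction (fun _ h0 => absurd (h.subset_zero v) h0.2) fun i ih hai hiv => ?_
    by_cases hi : par i = v
    · exact ⟨i, hi, hai⟩
    · exact ih ((h.ssubset_par i).1 hai)
        ((h.par_subset i v hiv).ssubset_of_ne fun h' => hi (h.injective h'))
  exact key (leg a) (h.mem_leg a hax)
    ((h.leg_subset a v ha).ssubset_of_ne fun h' => hleg (h.injective h'))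

/-- Children and legs other than `x` contribute at least two: without children all of `S v` sits at
`v`, and a child misses some element of `S v`, which sits at `v` or in a second child. The third
contribution is the leaf `x` at the root and the edge to the parent elsewhere. -/
lemma three_le (v : Fin (k + 1)) : 3 ≤ valenceOf (fun i => s(i.succ, par i)) leg v := by
  classical
  have hchild : 2 ≤ (Finset.univ.filter fun i => par i = v).card +
      (Finset.univ.filter fun a => leg a = v ∧ a ≠ x).card := by
    rcases (Finset.univ.filter fun i => par i = v).eq_empty_or_nonempty with he | ⟨i, hi⟩
    · refine (h.two_le v).trans (le_add_of_nonneg_of_le (Nat.zero_le _)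
        (Finset.card_le_card fun a ha => ?_))
      rcases h.leg_eq_or_exists_child ha with hl | ⟨i, hi, -⟩
      · refine Finset.mem_filter.2 ⟨Finset.mem_univ _, hl, ?_⟩
        rintro rfl
        exact h.notMem v ha
      · have : i ∈ Finset.univ.filter fun i => par i = v := by simp [hi]
        rw [he] at this
        simp at this
    · have hpos := Finset.card_pos.2 ⟨i, hi⟩
      rw [Finset.mem_filter] at hi
      have hss := h.ssubset_par i
      rw [hi.2] at hss
      obtain ⟨a, ha, hai⟩ := Finset.exists_of_ssubset hss
      rcases h.leg_eq_or_exists_child ha with hl | ⟨j, hj, haj⟩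
      · have : 0 < (Finset.univ.filter fun a => leg a = v ∧ a ≠ x).card := by
          refine Finset.card_pos.2 ⟨a, Finset.mem_filter.2 ⟨Finset.mem_univ _, hl, ?_⟩⟩
          rintro rfl
          exact h.notMem v ha
        omega
      · have hij : i ≠ j := by rintro rfl; exact hai haj
        have : 2 ≤ (Finset.univ.filter fun i => par i = v).card := by
          rw [← Finset.card_pair hij]
          refine Finset.card_le_card fun l hl => ?_
          rcases Finset.mem_insert.1 hl with rfl | hl
          · simp [hi.2]
          · rw [Finset.mem_singleton] at hl; simp [hl, hj]
        omega
  have hE : (Finset.univ.filter fun i => par i = v) ⊆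
      Finset.univ.filter fun i : Fin k => v ∈ s(i.succ, par i) := by
    intro i hi
    simp only [Finset.mem_filter, Finset.mem_univ, true_and, Sym2.mem_iff] at hi ⊢
    exact Or.inr hi.symm
  have hL : (Finset.univ.filter fun a => leg a = v ∧ a ≠ x) ⊆
      Finset.univ.filter fun a => leg a = v := by
    intro a ha
    simp only [Finset.mem_filter, Finset.mem_univ, true_and] at ha ⊢
    exact ha.1
  change 3 ≤ (Finset.univ.filter fun i : Fin k => v ∈ s(i.succ, par i)).card +
    (Finset.univ.filter fun a => leg a = v).card
  by_cases hv : v = 0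
  · have hlt := Finset.card_lt_card (hL.ssubset_of_ne fun he => by
      have hx : x ∈ Finset.univ.filter fun a => leg a = v := by simp [h.leg_root, hv]
      rw [← he] at hx
      simp at hx)
    have hle := Finset.card_le_card hE
    omega
  · obtain ⟨i, rfl⟩ := Fin.exists_succ_eq.2 hv
    have hlt := Finset.card_lt_card (hE.ssubset_of_ne fun he => by
      have hx : i ∈ Finset.univ.filter fun j : Fin k => i.succ ∈ s(j.succ, par j) := by simp
      rw [← he] at hx
      simp [h.par_ne] at hx)
    have hle := Finset.card_le_card hL
    omega

/-- The tree given by the combinatorial data. -/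
def toOrientedTree : OrientedTree r k where
  edge i := s(i.succ, par i)
  leg := leg
  isTree := h.isTree
  three_le := h.three_le

/-- The vertices below the edge `i` are those whose sets lie in `S i.succ`: the others reach the
root through their parents, and an edge other than `i` never leaves this collection. -/
lemma split_toOrientedTree (i : Fin k) : h.toOrientedTree.split x i = S i.succ := by
  have hadj : ∀ j, j ≠ i → (h.toOrientedTree.removeEdge i).Adj (par j) j.succ := fun j hj =>
    ((h.toOrientedTree.removeEdge_adj _ _ _).2 ⟨j, hj, Sym2.eq_swap⟩)
  have h1 : ∀ v, ¬ S v ⊆ S i.succ → (h.toOrientedTree.removeEdge i).Reachable 0 v := by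
    refine h.induction (fun _ => SimpleGraph.Reachable.refl _) fun j ih hj => ?_
    have hji : j ≠ i := by rintro rfl; exact hj subset_rfl
    exact (ih fun hp => hj ((h.ssubset_par j).1.trans hp)).trans (hadj j hji).reachable
  have h2 : ∀ u v, (h.toOrientedTree.removeEdge i).Reachable u v →
      (S u ⊆ S i.succ ↔ S v ⊆ S i.succ) := by
    rintro u v ⟨p⟩
    induction p with
    | nil => rfl
    | cons hadj _ ih =>
      rw [← ih]
      obtain ⟨l, hl, he⟩ := (h.toOrientedTree.removeEdge_adj _ _ _).1 hadj
      have hpar : S l.succ ⊆ S i.succ ↔ S (par l) ⊆ S i.succ :=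
        ⟨fun hs => h.par_subset l _ (hs.ssubset_of_ne fun h' =>
          hl (Fin.succ_injective _ (h.injective h'))), fun hs => (h.ssubset_par l).1.trans hs⟩
      change s(l.succ, par l) = _ at he
      rw [Sym2.eq_iff] at he
      rcases he with ⟨rfl, rfl⟩ | ⟨rfl, rfl⟩
      exacts [hpar, hpar.symm]
  have h0 : ¬ S 0 ⊆ S i.succ := fun h0 =>
    (h.ssubset_par i).2 ((h.subset_zero _).trans h0)
  have h3 : ∀ v, v ∈ h.toOrientedTree.below x i ↔ S v ⊆ S i.succ := by
    intro v
    change ¬ (h.toOrientedTree.removeEdge i).Reachable (leg x) v ↔ _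
    rw [h.leg_root]
    exact ⟨fun h' => by_contra fun hv => h' (h1 v hv), fun hv h' => h0 ((h2 _ _ h').2 hv)⟩
  ext a
  rw [OrientedTree.mem_split, h3]
  change S (leg a) ⊆ _ ↔ _
  by_cases hax : a = x
  · subst hax
    rw [h.leg_root]
    exact ⟨fun h' => absurd h' h0, fun h' => absurd h' (h.notMem _)⟩
  · exact ⟨fun h' => h' (h.mem_leg a hax), h.leg_subset a _⟩

end IsRootedTree

theorem OrientedTree.exists_split_eq {r k : ℕ} (hr : 3 ≤ r) (x : Fin r) (S : Fin k → Finset (Fin r))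
    (hinj : Function.Injective S) (hx : ∀ i, x ∉ S i) (h2 : ∀ i, 2 ≤ (S i).card)
    (hr2 : ∀ i, (S i).card + 2 ≤ r) (hS : ∀ i j, Laminar (S i) (S j)) :
    ∃ T : OrientedTree r k, T.split x = S := by
  obtain ⟨par, leg, h⟩ := exists_isRootedTree hr x S hinj hx h2 hr2 hS
  exact ⟨h.toOrientedTree, funext h.split_toOrientedTree⟩

end Existence

/-! ### The cyclic bar construction as a clique complex -/

section Ordered

variable {K : Type*} [Field K] {V : Type*}

lemma simplex_ofFn {n : ℕ} (f : Fin n → V) :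
    simplex K (List.ofFn f) = ExteriorAlgebra.ιMulti K n fun i => Finsupp.single (f i) (1 : K) := by
  rw [ExteriorAlgebra.ιMulti_apply, simplex, List.map_ofFn]
  rfl

lemma simplex_ofFn_comp_perm {n : ℕ} (f : Fin n → V) (σ : Equiv.Perm (Fin n)) :
    simplex K (List.ofFn (f ∘ σ)) = ((Equiv.Perm.sign σ : ℤ) : K) • simplex K (List.ofFn f) := by
  have h := (ExteriorAlgebra.ιMulti K n).map_perm (fun i => Finsupp.single (f i) (1 : K)) σ
  rw [simplex_ofFn, simplex_ofFn, Int.cast_smul_eq_zsmul, ← Units.smul_def, ← h]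
  rfl

lemma boundary_simplex_ofFn {n : ℕ} (f : Fin (n + 1) → V) :
    boundary K V (simplex K (List.ofFn f)) =
      ∑ i : Fin (n + 1), (-1 : K) ^ (i : ℕ) • simplex K (List.ofFn fun j => f (i.succAbove j)) := by
  induction n with
  | zero =>
    rw [List.ofFn_succ, simplex_cons, boundary_vertexGen_mul]
    simp [boundary, contraction_one]
  | succ n ih =>
    rw [List.ofFn_succ, simplex_cons, boundary_vertexGen_mul, ih]
    conv_rhs => rw [Fin.sum_univ_succ]
    simp only [Fin.val_zero, pow_zero, one_smul, Fin.zero_succAbove, Fin.val_succ, pow_succ,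
      mul_neg, mul_one, neg_smul, Finset.sum_neg_distrib, Finset.mul_sum, mul_smul_comm,
      ← sub_eq_add_neg]
    congr 1
    refine Finset.sum_congr rfl fun i _ => ?_
    rw [List.ofFn_succ (f := fun j => f (i.succ.succAbove j)), simplex_cons]
    simp

/-- Up to sign, these are distinct members of the standard basis of an exterior power; distinct
vertex sets give distinct basis vectors. -/
lemma linearIndependent_simplex {J : Type*} {n : ℕ} (l : J → List V) (hl : ∀ j, (l j).length = n)
    (hnodup : ∀ j, (l j).Nodup) (hinj : ∀ j j', (∀ v, v ∈ l j ↔ v ∈ l j') → j = j') :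
    LinearIndependent K fun j => simplex K (l j) := by
  classical
  let _ : LinearOrder V := linearOrderOfSTO WellOrderingRel
  have hb := exteriorPower.ιMulti_family_linearIndependent_ofBasis K n
    (Finsupp.basisSingleOne (R := K) (ι := V))
  have hb' := hb.map' (⋀[K]^n (V →₀ K)).subtype (Submodule.ker_subtype _)
  have hcard : ∀ j, (l j).toFinset.card = n := fun j => by
    rw [List.toFinset_card_of_nodup (hnodup j), hl]
  let g : J → Set.powersetCard V n := fun j => ⟨(l j).toFinset, hcard j⟩
  have hg : Function.Injective g := fun j j' h => hinj j j' fun v => by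
    have h' : (l j).toFinset = (l j').toFinset := congrArg Subtype.val h
    rw [← List.mem_toFinset, h', List.mem_toFinset]
  have hval : ∀ j, ((⋀[K]^n (V →₀ K)).subtype ∘ exteriorPower.ιMulti_family K n
      (Finsupp.basisSingleOne (R := K) (ι := V))) (g j) =
      simplex K (List.ofFn ((l j).toFinset.orderEmbOfFin (hcard j))) := by
    intro j
    rw [simplex_ofFn]
    simp only [Function.comp_apply, Submodule.subtype_apply, exteriorPower.ιMulti_family,
      exteriorPower.ιMulti_apply_coe]
    congr 1
  have hsign : ∀ j, ∃ u : Kˣ, simplex K (l j) = u • ((⋀[K]^n (V →₀ K)).subtype ∘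
      exteriorPower.ιMulti_family K n (Finsupp.basisSingleOne (R := K) (ι := V))) (g j) := by
    intro j
    rw [hval]
    have hperm : (l j).Perm (List.ofFn ((l j).toFinset.orderEmbOfFin (hcard j))) := by
      refine (List.perm_ext_iff_of_nodup (hnodup j) (List.nodup_ofFn.2
        (RelEmbedding.injective _))).2 fun v => ?_
      rw [List.mem_ofFn, ← Set.mem_range, Finset.range_orderEmbOfFin]
      simp
    rcases simplex_perm (K := K) hperm with h | h
    · exact ⟨1, by rw [h, one_smul]⟩
    · exact ⟨-1, by rw [h, Units.neg_smul, one_smul]⟩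
  choose u hu using hsign
  rw [show (fun j => simplex K (l j)) = _ from funext hu]
  exact (hb'.comp g hg).units_smul u

end Ordered

section ChainMap

universe u

variable (K : Type u) [Field K] {r k : ℕ} (x : Fin r)

/-- The chain spanned by the splits of a tree. -/
noncomputable def splitSimplex (T : OrientedTree r k) : SimplexAlgebra K (Finset (Fin r)) :=
  simplex K (List.ofFn (T.split x))

lemma splitSimplex_eq_of_isIso {T T' : OrientedTree r k} {φ : Equiv.Perm (Fin (k + 1))}
    {σ : Equiv.Perm (Fin k)} (h : T.IsIso T' φ σ) :
    splitSimplex K x T' = ((Equiv.Perm.sign σ : ℤ) : K) • splitSimplex K x T := by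
  have h1 : T.split x = T'.split x ∘ σ := funext fun i => (OrientedTree.split_eq_of_isIso h i).symm
  rw [splitSimplex, splitSimplex, h1, simplex_ofFn_comp_perm, smul_smul, ← Int.cast_mul,
    ← Units.val_mul, Int.units_mul_self]
  simp

lemma relations_le_ker_splitSimplex :
    relations K r k ≤ LinearMap.ker (Finsupp.linearCombination K (splitSimplex K (k := k) x)) := by
  refine Submodule.span_le.2 ?_
  rintro _ ⟨T, T', φ, σ, h, rfl⟩
  simp [splitSimplex_eq_of_isIso K x h]

/-- The comparison of the cyclic bar construction with the simplices spanned by the splits. -/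
noncomputable def splitMap (k : ℕ) : Chain K r k →ₗ[K] SimplexAlgebra K (Finset (Fin r)) :=
  (relations K r k).liftQ (Finsupp.linearCombination K (splitSimplex K x))
    (relations_le_ker_splitSimplex K x)

lemma splitMap_treeClass (T : OrientedTree r k) :
    splitMap K x k (treeClass K T) = splitSimplex K x T := by
  rw [splitMap, treeClass, Submodule.mkQ_apply, Submodule.liftQ_apply _ _
    (h := relations_le_ker_splitSimplex K x), Finsupp.linearCombination_single, one_smul]

lemma boundary_splitMap (z : Chain K r (k + 1)) :
    boundary K _ (splitMap K x (k + 1) z) = splitMap K x k (differential K r k z) := by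
  refine chain_induction K (p := fun z => boundary K _ (splitMap K x (k + 1) z) =
    splitMap K x k (differential K r k z)) z ?_ ?_ ?_
  · simp
  · intro y z hy hz; simp only [map_add, hy, hz]
  · intro a T
    simp only [map_smul, differential_treeClass, map_sum, splitMap_treeClass]
    rw [splitSimplex, boundary_simplex_ofFn]
    congr 1
    refine Finset.sum_congr rfl fun i _ => ?_
    rw [splitSimplex, funext (T.split_contract (x := x) i)]

/-- One tree is chosen for each occurring set of splits. Their classes span, since equal sets of
splits mean isomorphic trees up to reordering edges, and their images are linearly independent. In
particular no tree class vanishes, in any characteristic. -/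
lemma splitMap_injective : Function.Injective (splitMap K x k) := by
  classical
  let g : OrientedTree r k → Set (Finset (Fin r)) := fun T => Set.range (T.split x)
  let rep : Set.range g → OrientedTree r k := fun I => I.2.choose
  have hrep : ∀ I, Set.range ((rep I).split x) = I := fun I => I.2.choose_spec
  have hli : LinearIndependent K (splitMap K x k ∘ fun I => treeClass K (rep I)) := by
    have := linearIndependent_simplex (K := K) (n := k) (fun I => List.ofFn ((rep I).split x))
      (fun I => List.length_ofFn) (fun I => List.nodup_ofFn.2 (rep I).split_injective)
      (fun I J h => by
        refine Subtype.ext ?_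
        rw [← hrep I, ← hrep J]
        ext v
        simpa [List.mem_ofFn] using h v)
    convert this using 1
    funext I
    exact splitMap_treeClass K x (rep I)
  have hclass : ∀ T : OrientedTree r k, ∃ a : K, treeClass K T =
      a • treeClass K (rep ⟨g T, T, rfl⟩) := by
    intro T
    set T₀ := rep ⟨g T, T, rfl⟩ with hT₀
    have hr : Set.range (T₀.split x) = g T := hrep ⟨g T, T, rfl⟩
    have hex : ∀ i, ∃ j, T.split x j = T₀.split x i := fun i => by
      have : T₀.split x i ∈ Set.range (T.split x) := by
        change _ ∈ g T
        rw [← hr]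
        exact ⟨i, rfl⟩
      exact this
    choose s hs using hex
    have hsinj : Function.Injective s := fun i j h => T₀.split_injective (x := x) (by
      rw [← hs, ← hs, h])
    obtain ⟨φ, hφ⟩ := OrientedTree.exists_isIso (x := x) (T := T₀) (T' := T)
      (σ := Equiv.ofBijective s (Finite.injective_iff_bijective.1 hsinj)) hs
    exact ⟨_, treeClass_eq_of_isIso K hφ⟩
  have hspan : ∀ z : Chain K r k,
      z ∈ Submodule.span K (Set.range fun I => treeClass K (rep I)) := by
    intro z
    refine chain_induction K (p := fun z => z ∈ Submodule.span K
      (Set.range fun I => treeClass K (rep I))) z (Submodule.zero_mem _)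
      (fun y z hy hz => Submodule.add_mem _ hy hz) fun a T => Submodule.smul_mem _ _ ?_
    obtain ⟨b, hb⟩ := hclass T
    rw [hb]
    exact Submodule.smul_mem _ _ (Submodule.subset_span ⟨_, rfl⟩)
  rw [← LinearMap.ker_eq_bot, LinearMap.ker_eq_bot']
  intro z hz
  obtain ⟨c, rfl⟩ := Finsupp.mem_span_range_iff_exists_finsupp.1 (hspan z)
  have hc : c = 0 := by
    refine linearIndependent_iff.1 hli c ?_
    rw [Finsupp.linearCombination_apply]
    simpa [Finsupp.sum, map_sum] using hz
  simp [hc]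

lemma map_bridgelessChain (hr : 3 ≤ r) {C : Type*} (c : Fin r → C) :
    (bridgelessChain K c k).map (splitMap K x k) =
      cliqueChain K Laminar (colourSplitting c (Finset.univ.erase x)) k := by
  rw [bridgelessChain, Submodule.map_span]
  apply le_antisymm
  · refine Submodule.span_le.2 ?_
    rintro _ ⟨_, ⟨T, hT, rfl⟩, rfl⟩
    rw [splitMap_treeClass]
    refine simplex_mem_cliqueChain ⟨List.nodup_ofFn.2 T.split_injective, ?_, ?_⟩ List.length_ofFn
    · intro S hS
      obtain ⟨i, rfl⟩ := List.mem_ofFn.1 hS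
      have hx := T.root_notMem_split (x := x) i
      refine mem_colourSplitting.2 ⟨fun a ha => ?_, fun h => ?_, T.two_le_card_split i,
        T.isBridgeless_iff.1 hT i⟩
      · refine Finset.mem_erase.2 ⟨?_, Finset.mem_univ _⟩
        rintro rfl
        exact hx ha
      · have h1 := T.card_split_add_two_le (x := x) i
        rw [h, Finset.card_erase_of_mem (Finset.mem_univ _), Finset.card_univ,
          Fintype.card_fin] at h1
        omega
    · intro S hS S' hS'
      obtain ⟨i, rfl⟩ := List.mem_ofFn.1 hS
      obtain ⟨j, rfl⟩ := List.mem_ofFn.1 hS'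
      exact T.laminar_split i j
  · refine Submodule.span_le.2 ?_
    rintro _ ⟨l, hl, rfl, rfl⟩
    have hmem : ∀ i, l.get i ∈ colourSplitting c (Finset.univ.erase x) := fun i =>
      hl.2.1 _ (List.get_mem l i)
    simp only [mem_colourSplitting] at hmem
    obtain ⟨T, hT⟩ := OrientedTree.exists_split_eq hr x l.get hl.1.injective_get
      (fun i hx => by simpa using (hmem i).1 hx) (fun i => (hmem i).2.2.1)
      (fun i => by
        have h1 := Finset.card_lt_card ((hmem i).1.ssubset_of_ne (hmem i).2.1)
        rw [Finset.card_erase_of_mem (Finset.mem_univ _), Finset.card_univ,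
          Fintype.card_fin] at h1
        omega)
      (fun i j => hl.2.2 _ (List.get_mem l i) _ (List.get_mem l j))
    refine Submodule.subset_span ⟨treeClass K T, ⟨T, (T.isBridgeless_iff (x := x)).2 fun i => ?_,
      rfl⟩, ?_⟩
    · rw [hT]; exact (hmem i).2.2.2
    · rw [splitMap_treeClass, splitSimplex, hT, List.ofFn_get]

lemma boundary_splitMap_zero (z : Chain K r 0) : boundary K _ (splitMap K x 0 z) = 0 := by
  refine chain_induction K (p := fun z => boundary K _ (splitMap K x 0 z) = 0) z ?_ ?_ ?_
  · simp
  · intro y z hy hz; simp only [map_add, hy, hz, add_zero]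
  · intro a T
    simp [splitMap_treeClass, splitSimplex, boundary, contraction_one]

/-- The leaf `x` is chosen among two leaves of equal colour, so that its complement is itself
colour-splitting; acyclicity is then transported through `splitMap`. The cycle condition is void for
`k = 0`, where the boundary of the empty simplex vanishes anyway. -/
theorem exists_differential_eq (hr : 3 ≤ r) {C : Type*} (c : Fin r → C)
    (hc : ¬ Function.Injective c) (hk : k + 3 ≠ r) {z : Chain K r k} (hz : z ∈ bridgelessChain K c k)
    (hdz : ∀ j (h : k = j + 1), differential K r j (h ▸ z) = 0) :
    ∃ y ∈ bridgelessChain K c (k + 1), differential K r k y = z := by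
  obtain ⟨a, x, hax, hne⟩ : ∃ a x, c a = c x ∧ a ≠ x := by
    simpa [Function.Injective] using hc
  have htop := topAcyclic_colourSplitting c (r - 3) (Finset.univ.erase x)
    (by rw [Finset.card_erase_of_mem (Finset.mem_univ _), Finset.card_univ, Fintype.card_fin]
        omega)
    ⟨a, by simp [hne], x, by simp, hax⟩
  have hb : boundary K _ (splitMap K x k z) = 0 := by
    obtain _ | j := k
    · exact boundary_splitMap_zero K x z
    · rw [boundary_splitMap, hdz j rfl, map_zero]
  have hmem : splitMap K x k z ∈
      cliqueChain K Laminar (colourSplitting c (Finset.univ.erase x)) k := by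
    rw [← map_bridgelessChain K x hr c]
    exact Submodule.mem_map_of_mem hz
  obtain ⟨y, hy, hyz⟩ := htop.exact Laminar.refl (fun _ _ => Laminar.symm) (by omega) hmem hb
  rw [← map_bridgelessChain K x hr c] at hy
  obtain ⟨y, hy, rfl⟩ := hy
  refine ⟨y, hy, splitMap_injective K x ?_⟩
  rw [← boundary_splitMap, hyz]

end ChainMap

/-! ### Degrees -/

/-- The `k + 1` valences, each at least 3, add up to `2 * k + r`; equality characterises trivalent
trees. -/
lemma OrientedTree.add_three_le {r k : ℕ} (hr : 0 < r) (T : OrientedTree r k) : k + 3 ≤ r := by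
  have h := T.sum_valence_univ hr
  have h' : ∑ _v : Fin (k + 1), 3 ≤ ∑ v, T.valence v := Finset.sum_le_sum fun v _ => T.three_le v
  simp at h'
  omega

lemma OrientedTree.isTrivalent_iff {r k : ℕ} (hr : 0 < r) (T : OrientedTree r k) :
    T.IsTrivalent ↔ k + 3 = r := by
  have h := T.sum_valence_univ hr
  have h' := Finset.sum_eq_sum_iff_of_le (s := Finset.univ) (f := fun _ : Fin (k + 1) => 3)
    (g := T.valence) fun v _ => T.three_le v
  simp only [Finset.sum_const, Finset.card_univ, Fintype.card_fin, smul_eq_mul, Finset.mem_univ,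
    forall_const, h] at h'
  refine ⟨fun ht => ?_, fun hk v => (h'.1 (by omega) v).symm⟩
  have := h'.2 fun v => (ht v).symm
  omega

/-! ### The bridgeless complex -/

section Complex

open CategoryTheory

universe u

variable (K : Type u) [Field K] {r : ℕ} {C : Type*} (c : Fin r → C)

lemma bridgeless_d_apply (k : ℕ) (y : bridgelessChain K c (k + 1)) :
    (ConcreteCategory.hom (ChainComplex.of.d (fun k => ModuleCat.of K (bridgelessChain K c k))
      (fun k => ModuleCat.ofHom (bridgelessDifferential K c k)) (k + 1) k)) y =
      bridgelessDifferential K c k y := by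
  rw [ChainComplex.of_d]
  rfl

lemma bridgelessComplex_exactAt (hr : 3 ≤ r) (hc : ¬ Function.Injective c) {n : ℤ}
    (hn : n ≠ 3 - (r : ℤ)) : (bridgelessComplex K c).ExactAt n := by
  -- Positive degrees are not of the form `-k`; the complex is extended by zero there.
  by_cases hn' : ∃ k : ℕ, ComplexShape.embeddingDownNat.f k = n
  · obtain ⟨k, hk⟩ := hn'
    refine (HomologicalComplex.extend_exactAt_iff _ _ hk).2 ?_
    have hk' : k + 3 ≠ r := by
      rintro rfl
      apply hn
      rw [← hk]
      simp
    obtain _ | j := k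
    -- The index after 0 in a chain complex over ℕ is 0 by default, with zero differential, so every
    -- chain of degree 0 has to be a boundary.
    · rw [HomologicalComplex.exactAt_iff' _ 1 0 0 (by simp) (by simp),
        ShortComplex.moduleCat_exact_iff]
      rintro ⟨z, hz⟩ -
      obtain ⟨y, hy, hyz⟩ := exists_differential_eq K hr c hc hk' hz (by omega)
      refine ⟨⟨y, hy⟩, ?_⟩
      exact (bridgeless_d_apply K c 0 ⟨y, hy⟩).trans (Subtype.ext hyz)
    · rw [HomologicalComplex.exactAt_iff' _ (j + 2) (j + 1) j (by simp) (by simp),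
        ShortComplex.moduleCat_exact_iff]
      rintro ⟨z, hz⟩ hdz
      have hdz' := (bridgeless_d_apply K c j ⟨z, hz⟩).symm.trans hdz
      obtain ⟨y, hy, hyz⟩ := exists_differential_eq K hr c hc hk' hz (by
        intro i hi
        obtain rfl : j = i := by omega
        exact congrArg Subtype.val hdz')
      exact ⟨⟨y, hy⟩, (bridgeless_d_apply K c (j + 1) ⟨y, hy⟩).trans (Subtype.ext hyz)⟩
  · push Not at hn'
    exact HomologicalComplex.extend_exactAt _ _ _ hn'

lemma bridgelessComplex_isZero_X (hr : 0 < r) {n : ℤ} (hn : n < 3 - (r : ℤ)) :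
    Limits.IsZero ((bridgelessComplex K c).X n) := by
  by_cases hn' : ∃ k : ℕ, ComplexShape.embeddingDownNat.f k = n
  · obtain ⟨k, hk⟩ := hn'
    refine Limits.IsZero.of_iso ?_ (HomologicalComplex.extendXIso _ _ hk)
    have : IsEmpty (OrientedTree r k) := ⟨fun T => by
      have := T.add_three_le hr
      simp at hk
      omega⟩
    have hsub : Subsingleton (bridgelessChain K c k) := by
      infer_instance
    exact ModuleCat.isZero_of_subsingleton (ModuleCat.of K (bridgelessChain K c k))
  · push Not at hn'
    exact HomologicalComplex.isZero_extend_X _ _ _ hn'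

end Complex

end CyclicBar

/-! ### Vanishing of cohomology outside the bottom degree -/

theorem mainTheorem2 {K : Type*} [Field K] (r : ℕ) (hr : 3 ≤ r) (p : Composition r)
    (hN : p.length + 1 ≤ r) :
    (∀ n : ℤ, n ≠ 3 - (r : ℤ) →
      CategoryTheory.Limits.IsZero ((CyclicBar.bridgelessComplex K p.index).homology n)) ∧
    (∀ n : ℤ, n < 3 - (r : ℤ) →
      CategoryTheory.Limits.IsZero ((CyclicBar.bridgelessComplex K p.index).X n)) ∧
    (∀ (k : ℕ) (T : CyclicBar.OrientedTree r k),
      T.IsTrivalent ↔ -(k : ℤ) = 3 - (r : ℤ)) := by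
  refine ⟨fun n hn => ?_, fun n hn => CyclicBar.bridgelessComplex_isZero_X K _ (by omega) hn,
    fun k T => ?_⟩
  · rw [← HomologicalComplex.exactAt_iff_isZero_homology]
    refine CyclicBar.bridgelessComplex_exactAt K _ hr (fun h => ?_) hn
    have := Fintype.card_le_of_injective _ h
    simp only [Fintype.card_fin] at this
    omega
  · rw [T.isTrivalent_iff (by omega)]
    omega
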